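/- Let $\mathbb D=\{z\in\mathbb C:|z|<1\}$, let $dA=\frac1\pi\,dx\,dy$ be the normalized area measure on $\mathbb D$, and let $L_a^2$ be the Bergman space, i.e. the closed subspace of $L^2(\mathbb D,dA)$ consisting of analytic functions, with orthogonal projection $P:L^2(\mathbb D,dA)\to L_a^2$. Let $k_z=K_z/\|K_z\|_{L^2(\mathbb D,dA)}$, where $K_z(w)=(1-\bar z w)^{-2}$. For $z\in\mathbb D$ and $0<r<1$ put $E(z,r)=\{w\in\mathbb D: |\frac{w-z}{1-\bar w z}|<r\}$. For a finite positive Borel measure $\mu$ on $\mathbb D$, its Berezin transform is $\widetilde\mu(z)=\int_{\mathbb D}|k_z|^2\,d\mu$ ($z\in\mathbb D$); $\mu$ is called a reverse Carleson measure for $L_a^2$ if there is a constant $C>0$ with $\int_{\mathbb D}|f|^2d\mu\ge C\int_{\mathbb D}|f|^2dA$ for all $f\in L_a^2$. **Theorem.** Let $\varphi\in L^\infty(\mathbb D,dA)$ be real-valued with $\varphi\ge 0$ almost everywhere, and let $d\mu=\varphi\,dA$. Then the following are equivalent: (a) the Toeplitz operator $T_\varphi f=P(\varphi f)$ is invertible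 on $L_a^2$; (b) the Berezin transform $\widetilde\varphi=\widetilde\mu$ is invertible in $L^\infty(\mathbb D,dA)$; (b$'$) $\widetilde\varphi$ is bounded below on $\mathbb D$, i.e. there is $\delta>0$ with $|\widetilde\varphi(z)|\ge\delta$ for all $z\in\mathbb D$; (c) there is an $r>0$ such that $\chi_{\{z\in\mathbb D:\varphi(z)>r\}}\,dA$ is a reverse Carleson measure for $L_a^2$; (d) $\mu$ is a reverse Carleson measure for $L_a^2$; (e) $\mu$ satisfies the reverse Carleson condition: there are $r\in(0,1)$ and $C>0$ such that $C^{-1}\le \frac{\mu(E(z,r))}{A(E(z,r))}\le C$ for all $z\in\mathbb D$. -/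

import Mathlib

open MeasureTheory Filter Topology
open scoped ENNReal ComplexConjugate

noncomputable section

namespace Bergman

/-- The open unit disk. -/
def disk : Set ℂ := Metric.ball 0 1

/-- The normalized area measure `dA = (1 / π) dx dy` of the unit disk, as a measure on `ℂ`
carried by the disk. -/
def dA : Measure ℂ := (ENNReal.ofReal Real.pi)⁻¹ • volume.restrict disk

/-- `f` belongs to the Bergman space as a function: it is analytic on the disk and
square integrable there. Its values outside the disk play no role. -/
def IsBergman (f : ℂ → ℂ) : Prop :=
  DifferentiableOn ℂ f disk ∧ MemLp f 2 dA

/-- The Bergman space `L_a^2`, the subspace of `L^2(𝔻, dA)` of (classes of)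
analytic functions on the disk. -/
def bergmanSpace : Submodule ℂ (Lp ℂ 2 dA) where
  carrier := {F | ∃ f, IsBergman f ∧ F =ᵐ[dA] f}
  zero_mem' := ⟨0, ⟨differentiableOn_const 0, MemLp.zero⟩, Lp.coeFn_zero _ _ _⟩
  add_mem' := by
    rintro F G ⟨f, hf, hF⟩ ⟨g, hg, hG⟩
    exact ⟨f + g, ⟨hf.1.add hg.1, hf.2.add hg.2⟩, (Lp.coeFn_add F G).trans (hF.add hG)⟩
  smul_mem' := by
    rintro c F ⟨f, hf, hF⟩
    exact ⟨c • f, ⟨hf.1.const_smul c, hf.2.const_smul c⟩,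
      (Lp.coeFn_smul c F).trans (hF.const_smul c)⟩

theorem isProbabilityMeasure_dA : IsProbabilityMeasure dA := by
  refine ⟨?_⟩
  have h : ENNReal.ofReal Real.pi ≠ 0 := by simp [Real.pi_pos]
  simp only [dA, disk, Measure.smul_apply, Measure.restrict_apply_univ, Complex.volume_ball,
    smul_eq_mul]
  have : (NNReal.pi : ℝ≥0∞) = ENNReal.ofReal Real.pi := by
    rw [← NNReal.coe_real_pi, ENNReal.ofReal_coe_nnreal]
  rw [this]
  simp [ENNReal.inv_mul_cancel h ENNReal.ofReal_ne_top]

instance : IsProbabilityMeasure dA := isProbabilityMeasure_dA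

theorem lintegral_dA (g : ℂ → ℝ≥0∞) :
    ∫⁻ w in disk, g w = ENNReal.ofReal Real.pi * ∫⁻ w, g w ∂dA := by
  have h : ENNReal.ofReal Real.pi ≠ 0 := by simp [Real.pi_pos]
  rw [dA, lintegral_smul_measure, smul_eq_mul, ← mul_assoc,
    ENNReal.mul_inv_cancel h ENNReal.ofReal_ne_top, one_mul]

theorem circle_bound {g : ℂ → ℂ} {ρ : ℝ} (hρ : 0 < ρ)
    (hg : DiffContOnCl ℂ g (Metric.ball 0 ρ)) :
    ENNReal.ofReal (2 * Real.pi) * ‖g 0‖ₑ ≤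
      ∫⁻ θ in Set.Ioo (-Real.pi) Real.pi, ‖g (Complex.polarCoord.symm (ρ, θ))‖ₑ := by
  have h := DiffContOnCl.circleAverage (f := g) (c := 0) (R := ρ) (by rwa [abs_of_pos hρ])
  rw [Real.circleAverage_eq_integral_add (-Real.pi),
    intervalIntegral.integral_comp_add_right (fun θ => g (circleMap 0 ρ θ))] at h
  have e1 : (0 : ℝ) + -Real.pi = -Real.pi := by ring
  have e2 : 2 * Real.pi + -Real.pi = Real.pi := by ring
  have hpi : (0 : ℝ) < 2 * Real.pi := by positivity
  rw [e1, e2, intervalIntegral.integral_of_le (by linarith), integral_Ioc_eq_integral_Ioo,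
    inv_smul_eq_iff₀ hpi.ne'] at h
  have h2 : ∀ θ : ℝ, Complex.polarCoord.symm (ρ, θ) = circleMap 0 ρ θ := by
    intro θ
    rw [Complex.polarCoord_symm_apply, circleMap, Complex.exp_mul_I]
    simp
  simp only [h2]
  calc ENNReal.ofReal (2 * Real.pi) * ‖g 0‖ₑ = ‖(2 * Real.pi) • g 0‖ₑ := by
        rw [enorm_smul, Real.enorm_eq_ofReal hpi.le]
    _ ≤ _ := by
        rw [← h]
        exact enorm_integral_le_lintegral_enorm _

theorem point_bound {f : ℂ → ℂ} (hf : DifferentiableOn ℂ f disk) {z : ℂ} {r : ℝ} (hr : 0 < r)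
    (hz : ‖z‖ + r < 1) :
    ENNReal.ofReal (r ^ 2 / 2) * ‖f z‖ₑ ≤ eLpNorm f 2 dA := by
  classical
  have hsub : ∀ w : ℂ, ‖w‖ ≤ r → z + w ∈ disk := by
    intro w hw
    rw [disk, mem_ball_zero_iff]
    exact (norm_add_le z w).trans_lt (by linarith)
  have hdisk : MeasurableSet disk := Metric.isOpen_ball.measurableSet
  have hmeas : Measurable (disk.piecewise f 0) :=
    hf.continuousOn.measurable_piecewise continuousOn_const hdisk
  have hmeas' : AEStronglyMeasurable f dA := by
    refine hmeas.aestronglyMeasurable.congr ?_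
    filter_upwards [Measure.ae_smul_measure (ae_restrict_mem hdisk) _] with w hw
    exact Set.piecewise_eq_of_mem _ _ _ hw
  set h : ℂ → ℝ≥0∞ := (Metric.ball 0 r).indicator (fun w => ‖disk.piecewise f 0 (z + w)‖ₑ) with hh
  have hmeash : Measurable h :=
    ((hmeas.comp (measurable_const_add z)).enorm).indicator Metric.isOpen_ball.measurableSet
  have hpol : Measurable fun p : ℝ × ℝ => Complex.polarCoord.symm p := by
    simp only [Complex.polarCoord_symm_apply]
    fun_prop
  have hval : ∀ ρ ∈ Set.Ioo (r / 2) r,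
      ENNReal.ofReal (2 * Real.pi) * ‖f z‖ₑ ≤
        ∫⁻ θ in Set.Ioo (-Real.pi) Real.pi, h (Complex.polarCoord.symm (ρ, θ)) := by
    intro ρ hρ
    have hρ0 : 0 < ρ := by linarith [hρ.1]
    have hd : DiffContOnCl ℂ (fun w => f (z + w)) (Metric.ball 0 ρ) := by
      apply DifferentiableOn.diffContOnCl
      rw [closure_ball _ hρ0.ne']
      refine hf.comp (by fun_prop) ?_
      intro w hw
      exact hsub w (by rw [mem_closedBall_zero_iff] at hw; linarith [hρ.2])
    have hc := circle_bound hρ0 hd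
    simp only [add_zero] at hc
    refine hc.trans (le_of_eq ?_)
    refine lintegral_congr fun θ => ?_
    have hn : ‖Complex.polarCoord.symm (ρ, θ)‖ = ρ := by
      rw [Complex.norm_polarCoord_symm, abs_of_pos hρ0]
    rw [hh, Set.indicator_of_mem (by rw [mem_ball_zero_iff, hn]; exact hρ.2),
      Set.piecewise_eq_of_mem _ _ _ (hsub _ (by rw [hn]; exact hρ.2.le))]
  have hlow : ENNReal.ofReal Real.pi * (ENNReal.ofReal (r ^ 2 / 2) * ‖f z‖ₑ) ≤ ∫⁻ w, h w := by
    rw [← Complex.lintegral_comp_polarCoord_symm, polarCoord_target,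
      Measure.volume_eq_prod, ← Measure.prod_restrict, lintegral_prod _
        (by
          simp only [smul_eq_mul]
          exact ((measurable_fst.ennreal_ofReal).mul (hmeash.comp hpol)).aemeasurable)]
    calc ENNReal.ofReal Real.pi * (ENNReal.ofReal (r ^ 2 / 2) * ‖f z‖ₑ)
        = ∫⁻ ρ in Set.Ioo (r / 2) r,
            ENNReal.ofReal (r / 2) * (ENNReal.ofReal (2 * Real.pi) * ‖f z‖ₑ) := by
          rw [setLIntegral_const, Real.volume_Ioo, ← mul_assoc, ← mul_assoc,
            mul_right_comm _ ‖f z‖ₑ,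
            ← ENNReal.ofReal_mul (by positivity), ← ENNReal.ofReal_mul (by positivity),
            ← ENNReal.ofReal_mul (by positivity)]
          congr 2
          ring
      _ ≤ ∫⁻ ρ in Set.Ioo (r / 2) r, ∫⁻ θ in Set.Ioo (-Real.pi) Real.pi,
            ENNReal.ofReal ρ • h (Complex.polarCoord.symm (ρ, θ)) := by
          refine setLIntegral_mono' measurableSet_Ioo fun ρ hρ => ?_
          simp only [smul_eq_mul]
          have hm : Measurable fun θ : ℝ => h (Complex.polarCoord.symm (ρ, θ)) :=
            hmeash.comp (hpol.comp measurable_prodMk_left)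
          rw [lintegral_const_mul _ hm]
          exact mul_le_mul' (ENNReal.ofReal_le_ofReal hρ.1.le) (hval ρ hρ)
      _ ≤ _ := by
          refine lintegral_mono_set ?_
          intro ρ hρ
          exact lt_trans (by positivity) hρ.1
  have hup : ∫⁻ w, h w ≤ ENNReal.ofReal Real.pi * eLpNorm f 1 dA := by
    rw [eLpNorm_one_eq_lintegral_enorm, ← lintegral_dA, ← lintegral_indicator hdisk,
      ← lintegral_add_left_eq_self (disk.indicator fun w => ‖f w‖ₑ) z]
    refine lintegral_mono fun w => ?_
    rw [hh]
    by_cases hw : w ∈ Metric.ball (0 : ℂ) r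
    swap
    · rw [Set.indicator_of_notMem hw]
      exact zero_le
    rw [Set.indicator_of_mem hw]
    have hm := hsub w (mem_ball_zero_iff.1 hw).le
    rw [Set.piecewise_eq_of_mem _ _ _ hm, Set.indicator_of_mem hm]
  have hpi : ENNReal.ofReal Real.pi ≠ 0 := by simp [Real.pi_pos]
  have := (ENNReal.mul_le_mul_iff_right hpi ENNReal.ofReal_ne_top).1 (hlow.trans hup)
  exact this.trans (eLpNorm_le_eLpNorm_of_exponent_le (by norm_num) hmeas')

theorem isClosed_bergmanSpace : IsClosed (bergmanSpace : Set (Lp ℂ 2 dA)) := by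
  rw [← isSeqClosed_iff_isClosed]
  intro F G hF hFG
  choose f hf hFf using hF
  have hG : ∃ g : ℂ → ℂ, DifferentiableOn ℂ g disk ∧ ∀ z ∈ disk,
      Tendsto (fun n => f n z) atTop (𝓝 (g z)) := by
    have hdiff : ∀ m n, eLpNorm (f m - f n) 2 dA = ENNReal.ofReal (dist (F m) (F n)) := by
      intro m n
      rw [← edist_dist, Lp.edist_def]
      exact eLpNorm_congr_ae ((hFf m).sub (hFf n)).symm
    have hC : ∀ R : ℝ, R < 1 → UniformCauchySeqOn f atTop (Metric.closedBall 0 R) := by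
      intro R hR
      rw [Metric.uniformCauchySeqOn_iff]
      intro ε hε
      set r := (1 - R) / 2 with hr
      have hr0 : 0 < r := by rw [hr]; linarith
      obtain ⟨N, hN⟩ := Metric.cauchySeq_iff.1 hFG.cauchySeq (r ^ 2 / 2 * ε) (by positivity)
      refine ⟨N, fun m hm n hn z hz => ?_⟩
      have hb := point_bound ((hf m).1.sub (hf n).1) (z := z) hr0
        (by rw [mem_closedBall_zero_iff] at hz; rw [hr]; linarith)
      rw [hdiff, ← ofReal_norm, ← ENNReal.ofReal_mul (by positivity),
        ENNReal.ofReal_le_ofReal_iff dist_nonneg] at hb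
      have := hb.trans_lt (hN m hm n hn)
      rw [dist_eq_norm]
      exact lt_of_mul_lt_mul_left this (by positivity)
    have hp : ∀ z ∈ disk, ∃ l, Tendsto (fun n => f n z) atTop (𝓝 l) := by
      intro z hz
      apply cauchySeq_tendsto_of_complete
      exact (hC ‖z‖ (mem_ball_zero_iff.1 hz)).cauchySeq (by simp)
    choose! g hg using hp
    refine ⟨g, ?_, hg⟩
    refine TendstoLocallyUniformlyOn.differentiableOn (F := f) (φ := atTop) ?_
      (Eventually.of_forall fun n => (hf n).1) Metric.isOpen_ball
    rw [tendstoLocallyUniformlyOn_iff_forall_isCompact (show IsOpen disk from Metric.isOpen_ball)]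
    intro K hK hKc
    rcases K.eq_empty_or_nonempty with rfl | hne
    · exact tendstoUniformlyOn_empty
    obtain ⟨x, hx, hmax⟩ := hKc.exists_isMaxOn hne continuous_norm.continuousOn
    have hx1 : ‖x‖ < 1 := mem_ball_zero_iff.1 (hK hx)
    refine ((hC ‖x‖ hx1).mono fun y hy => ?_).tendstoUniformlyOn_of_tendsto
      fun y hy => hg y (hK hy)
    rw [mem_closedBall_zero_iff]
    exact hmax hy
  obtain ⟨g, hg, hlim⟩ := hG
  have hae : G =ᵐ[dA] g := by
    have h1 := tendstoInMeasure_of_tendsto_Lp hFG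
    obtain ⟨ns, hns, h2⟩ := h1.exists_seq_tendsto_ae
    have h3 : ∀ᵐ z ∂dA, z ∈ disk :=
      Measure.ae_smul_measure (ae_restrict_mem Metric.isOpen_ball.measurableSet) _
    filter_upwards [h2, h3, ae_all_iff.2 hFf] with z h2 h3 h4
    simp only [h4] at h2
    exact tendsto_nhds_unique h2 ((hlim z h3).comp hns.tendsto_atTop)
  exact ⟨g, ⟨hg, (memLp_congr_ae hae).1 (Lp.memLp G)⟩, hae⟩

instance : CompleteSpace bergmanSpace := isClosed_bergmanSpace.completeSpace_coe

/-- The Toeplitz operator `T_φ f = P (φ f)` on the Bergman space, `φ ∈ L^∞(𝔻, dA)`, where `P` is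
the orthogonal projection of `L^2(𝔻, dA)` onto the Bergman space. -/
def toeplitz (φ : ℂ → ℂ) (hφ : MemLp φ ∞ dA) : bergmanSpace →L[ℂ] bergmanSpace :=
  bergmanSpace.orthogonalProjectionOnto ∘L
    ((ContinuousLinearMap.mul ℂ ℂ).holderL dA ∞ 2 2 (hφ.toLp φ)) ∘L bergmanSpace.subtypeL

/-- The reproducing kernel `K_z(w) = 1 / (1 - conj z * w)^2`. -/
def kernel (z w : ℂ) : ℂ := 1 / (1 - conj z * w) ^ 2

/-- The normalized reproducing kernel `k_z = K_z / ‖K_z‖`, with the norm of `L^2(𝔻, dA)`. -/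
def normalizedKernel (z w : ℂ) : ℂ :=
  kernel z w / (Real.sqrt (∫ v, ‖kernel z v‖ ^ 2 ∂dA) : ℝ)

/-- The Berezin transform of a measure on the disk. -/
def berezin (μ : Measure ℂ) (z : ℂ) : ℝ :=
  ∫ w in disk, ‖normalizedKernel z w‖ ^ 2 ∂μ

/-- The function `u` is an invertible element of the algebra `L^∞(𝔻, dA)`. -/
def IsInvertibleLinfty (u : ℂ → ℝ) : Prop :=
  MemLp u ∞ dA ∧ ∃ v : ℂ → ℝ, MemLp v ∞ dA ∧ ∀ᵐ z ∂dA, u z * v z = 1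

/-- The function `u` is bounded below (in modulus, by a positive constant) on the disk. -/
def IsBoundedBelowOnDisk (u : ℂ → ℝ) : Prop :=
  ∃ δ : ℝ, 0 < δ ∧ ∀ z ∈ disk, δ ≤ |u z|

/-- The measure `μ` is a reverse Carleson measure for the Bergman space. -/
def IsReverseCarleson (μ : Measure ℂ) : Prop :=
  ∃ C : ℝ, 0 < C ∧ ∀ f : ℂ → ℂ, IsBergman f →
    ENNReal.ofReal C * ∫⁻ z in disk, ‖f z‖ₑ ^ 2 ∂dA ≤ ∫⁻ z in disk, ‖f z‖ₑ ^ 2 ∂μ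

/-- The pseudo-hyperbolic distance. -/
def rho (z w : ℂ) : ℝ := ‖(w - z) / (1 - conj w * z)‖

/-- The pseudo-hyperbolic disk with center `z` and radius `r`. -/
def pseudoDisk (z : ℂ) (r : ℝ) : Set ℂ := {w ∈ disk | rho z w < r}

/-- The reverse Carleson condition: for some `r`, the averages of `μ` over the pseudo-hyperbolic
disks of radius `r` are bounded above and below. -/
def ReverseCarlesonCondition (μ : Measure ℂ) : Prop :=
  ∃ r : ℝ, 0 < r ∧ r < 1 ∧ ∃ C : ℝ, 0 < C ∧ ∀ z ∈ disk,
    C⁻¹ ≤ μ.real (pseudoDisk z r) / dA.real (pseudoDisk z r) ∧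
      μ.real (pseudoDisk z r) / dA.real (pseudoDisk z r) ≤ C

/-- The measure `φ dA`, for a nonnegative function `φ`. -/
def measureOf (φ : ℂ → ℝ) : Measure ℂ := dA.withDensity fun z => ENNReal.ofReal (φ z)

/-- The measure `χ_G dA`. -/
def charMeasure (G : Set ℂ) : Measure ℂ := dA.restrict G

end Bergman

end

/-
Since `⟪T_φ f, f⟫ = ∫ ‖f‖² dμ`, the positive operator `T_φ` is invertible exactly when `μ` is a
reverse Carleson measure, and testing this on the normalized kernels bounds the Berezin transform
from below. As `|k_z|² dA` is the image of `dA` under the disk automorphism exchanging `0` and `z`,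
the part of the Berezin transform carried outside `E(z, r)` is at most `‖φ‖_∞ (1 - r²)`; for `r`
close to `1` a lower bound for the transform is thus one for `μ(E(z, r)) / A(E(z, r))`. Boundedness
of `φ` turns this into a lower bound for the density of a superlevel set of `φ` in every `E(z, r)`,
and there remains Luecking's theorem, that a set `G` of density at least `δ` in every `E(z, r)`
satisfies `∫ ‖f‖² dA ≤ C ∫_G ‖f‖² dA`.

For Luecking's theorem, let `g` be the composition of `f` with the automorphism for `z`. If a
weighted mean of `‖g‖²` over the disk is at most `K ‖g 0‖²`, then `g` is bounded on compact sets by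
a multiple of `‖g 0‖`, and Jensen's inequality (subharmonicity of `log ‖g‖`) keeps `‖g‖` above a
multiple of `‖g 0‖` on a fixed proportion of any set of measure at least `δ`. The remaining points
`z` contribute little: there `‖f z‖²` is less than `1 / K` times a mean, and averaging increases
integrals by at most a constant factor.
-/

noncomputable section

namespace Bergman

open Metric Set
open scoped NNReal Real

section PositiveOperator

variable {H : Type*} [NormedAddCommGroup H] [InnerProductSpace ℂ H] [CompleteSpace H]

theorem algebraMap_le_iff {T : H →L[ℂ] H} (hT : IsSelfAdjoint T) {c : ℝ} :
    algebraMap ℝ (H →L[ℂ] H) c ≤ T ↔ ∀ x, c * ‖x‖ ^ 2 ≤ T.reApplyInnerSelf x := by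
  have hsa : IsSelfAdjoint (T - algebraMap ℝ (H →L[ℂ] H) c) := hT.sub (.algebraMap _ (.all c))
  rw [ContinuousLinearMap.le_def, ContinuousLinearMap.isPositive_def, and_iff_right hsa.isSymmetric]
  refine forall_congr' fun x => ?_
  simp [ContinuousLinearMap.reApplyInnerSelf_apply, Algebra.algebraMap_eq_smul_one,
    inner_sub_left, inner_smul_left_eq_smul, ← Complex.ofReal_pow]

theorem isUnit_iff_exists_le_reApplyInnerSelf {T : H →L[ℂ] H} (hT : T.IsPositive) :
    IsUnit T ↔ ∃ c : ℝ, 0 < c ∧ ∀ x, c * ‖x‖ ^ 2 ≤ T.reApplyInnerSelf x := by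
  rcases subsingleton_or_nontrivial H with _ | _
  · exact iff_of_true (isUnit_of_subsingleton T)
      ⟨1, one_pos, fun x => by simp [Subsingleton.elim x 0, ContinuousLinearMap.reApplyInnerSelf]⟩
  have hT0 : 0 ≤ T := (ContinuousLinearMap.nonneg_iff_isPositive T).2 hT
  have h : IsUnit T ↔ IsStrictlyPositive T := by
    rw [IsStrictlyPositive.iff_of_unital, and_iff_right hT0]
  rw [h, StarOrderedRing.isStrictlyPositive_iff_spectrum_pos (R := ℝ) T hT.isSelfAdjoint,
    ← CFC.exists_pos_algebraMap_le_iff hT.isSelfAdjoint]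
  exact exists_congr fun c => and_congr_right fun _ => algebraMap_le_iff hT.isSelfAdjoint

end PositiveOperator

section Measure

variable {α : Type*} [MeasurableSpace α] {μ : Measure α}

theorem ofReal_norm_sq {E : Type*} [SeminormedAddCommGroup E] (x : E) :
    ENNReal.ofReal (‖x‖ ^ 2) = ‖x‖ₑ ^ 2 := by
  rw [ENNReal.ofReal_pow (norm_nonneg _), ofReal_norm]

theorem ofReal_norm_sq_Lp_two {E : Type*} [NormedAddCommGroup E] (F : Lp E 2 μ) :
    ENNReal.ofReal (‖F‖ ^ 2) = ∫⁻ x, ‖F x‖ₑ ^ 2 ∂μ := by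
  rw [ofReal_norm_sq, Lp.enorm_def]
  simpa using eLpNorm_nnreal_pow_eq_lintegral (f := F) (μ := μ) (p := 2) two_ne_zero

theorem holderL_mul_toLp_ae_eq {φ : α → ℂ} (hφ : MemLp φ ∞ μ) (F : Lp ℂ 2 μ) :
    (ContinuousLinearMap.mul ℂ ℂ).holderL μ ∞ 2 2 (hφ.toLp φ) F =ᵐ[μ] fun x => φ x * F x := by
  have h := (ContinuousLinearMap.mul ℂ ℂ).coeFn_holder (r := 2) (hφ.toLp φ) F
  filter_upwards [h, hφ.coeFn_toLp] with x h₁ h₂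
  rw [ContinuousLinearMap.holderL_apply_apply, h₁, h₂, ContinuousLinearMap.mul_apply']

theorem inner_holderL_mul_self {φ : α → ℝ} (hφ : MemLp (fun x => (φ x : ℂ)) ∞ μ) (F : Lp ℂ 2 μ) :
    inner ℂ ((ContinuousLinearMap.mul ℂ ℂ).holderL μ ∞ 2 2 (hφ.toLp _) F) F =
      ((∫ x, φ x * ‖F x‖ ^ 2 ∂μ : ℝ) : ℂ) := by
  rw [L2.inner_def, ← integral_complex_ofReal]
  refine integral_congr_ae ?_
  filter_upwards [holderL_mul_toLp_ae_eq hφ F] with x hx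
  rw [hx, RCLike.inner_apply, map_mul, Complex.conj_ofReal, mul_left_comm, Complex.mul_conj']
  push_cast
  rfl

theorem integrable_mul_norm_sq {φ : α → ℝ} (hφ : MemLp φ ∞ μ) (F : Lp ℂ 2 μ) :
    Integrable (fun x => φ x * ‖F x‖ ^ 2) μ :=
  (Lp.memLp F).integrable_norm_pow two_ne_zero |>.bdd_mul hφ.1 (ae_le_lpNorm_exponent_top hφ)

end Measure

section Toeplitz

theorem mem_disk {z : ℂ} : z ∈ disk ↔ ‖z‖ < 1 := mem_ball_zero_iff

theorem isOpen_disk : IsOpen disk := isOpen_ball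

theorem measurableSet_disk : MeasurableSet disk := isOpen_disk.measurableSet

theorem ae_mem_disk : ∀ᵐ z ∂dA, z ∈ disk :=
  Measure.ae_smul_measure (ae_restrict_mem measurableSet_disk) _

theorem restrict_disk_of_absolutelyContinuous {μ : Measure ℂ} (hμ : μ ≪ dA) :
    μ.restrict disk = μ :=
  Measure.restrict_eq_self_of_ae_mem (hμ.ae_le ae_mem_disk)

theorem restrict_disk_dA : dA.restrict disk = dA :=
  restrict_disk_of_absolutelyContinuous .rfl

theorem measureOf_absolutelyContinuous (φ : ℂ → ℝ) : measureOf φ ≪ dA :=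
  withDensity_absolutelyContinuous _ _

theorem lintegral_measureOf {φ : ℂ → ℝ} (hφ : AEMeasurable φ dA) (f : ℂ → ℝ≥0∞) :
    ∫⁻ z, f z ∂measureOf φ = ∫⁻ z, ENNReal.ofReal (φ z) * f z ∂dA :=
  lintegral_withDensity_eq_lintegral_mul_non_measurable₀ _ hφ.ennreal_ofReal
    (ae_of_all _ fun _ => ENNReal.ofReal_lt_top) f

theorem isReverseCarleson_iff_forall_bergmanSpace {μ : Measure ℂ} (hμ : μ ≪ dA) :
    IsReverseCarleson μ ↔ ∃ C : ℝ, 0 < C ∧ ∀ F : bergmanSpace,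
      ENNReal.ofReal (C * ‖F‖ ^ 2) ≤ ∫⁻ z, ‖(F : Lp ℂ 2 dA) z‖ₑ ^ 2 ∂μ := by
  have lintegral_congr_sq {ν : Measure ℂ} (hν : ν ≪ dA) {f g : ℂ → ℂ} (h : f =ᵐ[dA] g) :
      ∫⁻ z, ‖f z‖ₑ ^ 2 ∂ν = ∫⁻ z, ‖g z‖ₑ ^ 2 ∂ν :=
    lintegral_congr_ae <| (hν.ae_eq h).mono fun z hz => by simp only [hz]
  rw [IsReverseCarleson, restrict_disk_of_absolutelyContinuous hμ, restrict_disk_dA]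
  refine exists_congr fun C => and_congr_right fun hC => ⟨fun h F => ?_, fun h f hf => ?_⟩
  · obtain ⟨f, hf, hFf⟩ := F.2
    rw [ENNReal.ofReal_mul hC.le, Submodule.coe_norm, ofReal_norm_sq_Lp_two,
      lintegral_congr_sq .rfl hFf, lintegral_congr_sq hμ hFf]
    exact h f hf
  · have hF := h ⟨hf.2.toLp f, f, hf, hf.2.coeFn_toLp⟩
    rwa [ENNReal.ofReal_mul hC.le, Submodule.coe_norm, ofReal_norm_sq_Lp_two,
      lintegral_congr_sq .rfl hf.2.coeFn_toLp, lintegral_congr_sq hμ hf.2.coeFn_toLp] at hF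

variable {φ : ℂ → ℝ}

theorem inner_toeplitz_self (hφ : MemLp φ ∞ dA) (F : bergmanSpace) :
    inner ℂ (toeplitz (fun z => (φ z : ℂ)) hφ.ofReal F) F =
      ((∫ z, φ z * ‖(F : Lp ℂ 2 dA) z‖ ^ 2 ∂dA : ℝ) : ℂ) :=
  (Submodule.inner_orthogonalProjectionOnto_eq_of_mem_right F _).trans
    (inner_holderL_mul_self hφ.ofReal F)

theorem integral_mul_norm_sq_nonneg (hpos : ∀ᵐ z ∂dA, 0 ≤ φ z) (F : Lp ℂ 2 dA) :
    0 ≤ ∫ z, φ z * ‖F z‖ ^ 2 ∂dA :=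
  integral_nonneg_of_ae (hpos.mono fun _ hz => mul_nonneg hz (sq_nonneg _))

theorem lintegral_norm_sq_measureOf (hφ : MemLp φ ∞ dA) (hpos : ∀ᵐ z ∂dA, 0 ≤ φ z)
    (F : Lp ℂ 2 dA) :
    ∫⁻ z, ‖F z‖ₑ ^ 2 ∂measureOf φ = ENNReal.ofReal (∫ z, φ z * ‖F z‖ ^ 2 ∂dA) := by
  rw [lintegral_measureOf hφ.1.aemeasurable,
    ofReal_integral_eq_lintegral_ofReal (integrable_mul_norm_sq hφ F)
      (hpos.mono fun _ hz => mul_nonneg hz (sq_nonneg _))]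
  refine lintegral_congr_ae (hpos.mono fun z hz => ?_)
  simp only [ENNReal.ofReal_mul hz, ofReal_norm_sq]

theorem isPositive_toeplitz (hφ : MemLp φ ∞ dA) (hpos : ∀ᵐ z ∂dA, 0 ≤ φ z) :
    (toeplitz (fun z => (φ z : ℂ)) hφ.ofReal).IsPositive := by
  refine (ContinuousLinearMap.isPositive_iff_complex _).2 fun F => ?_
  rw [inner_toeplitz_self hφ]
  exact ⟨rfl, integral_mul_norm_sq_nonneg hpos F⟩

theorem isUnit_toeplitz_iff (hφ : MemLp φ ∞ dA) (hpos : ∀ᵐ z ∂dA, 0 ≤ φ z) :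
    IsUnit (toeplitz (fun z => (φ z : ℂ)) hφ.ofReal) ↔ IsReverseCarleson (measureOf φ) := by
  rw [isUnit_iff_exists_le_reApplyInnerSelf (isPositive_toeplitz hφ hpos),
    isReverseCarleson_iff_forall_bergmanSpace (measureOf_absolutelyContinuous φ)]
  refine exists_congr fun c => and_congr_right fun _ => forall_congr' fun F => ?_
  rw [ContinuousLinearMap.reApplyInnerSelf_apply, inner_toeplitz_self hφ,
    lintegral_norm_sq_measureOf hφ hpos,
    ENNReal.ofReal_le_ofReal_iff (integral_mul_norm_sq_nonneg hpos F)]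
  rfl

end Toeplitz

section BoundedBelow

variable {u : ℂ → ℝ}

theorem aestronglyMeasurable_of_continuousOn_disk {E : Type*} [TopologicalSpace E]
    [TopologicalSpace.PseudoMetrizableSpace E] [SecondCountableTopology E] {f : ℂ → E}
    (hf : ContinuousOn f disk) : AEStronglyMeasurable f dA :=
  (hf.aestronglyMeasurable measurableSet_disk).mono_ac Measure.smul_absolutelyContinuous

theorem IsBoundedBelowOnDisk.of_ae_le (hu : ContinuousOn u disk) {δ : ℝ} (hδ : 0 < δ)
    (h : ∀ᵐ z ∂dA, δ ≤ |u z|) : IsBoundedBelowOnDisk u := by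
  have hae : (fun z => min |u z| δ) =ᵐ[volume.restrict disk] fun _ => δ := by
    have hac : volume.restrict disk ≪ dA :=
      Measure.absolutelyContinuous_smul (ENNReal.inv_ne_zero.2 ENNReal.ofReal_ne_top)
    exact hac.ae_le (h.mono fun z hz => min_eq_right hz)
  have heq := Measure.eqOn_open_of_ae_eq hae isOpen_disk (hu.abs.inf continuousOn_const)
    continuousOn_const
  exact ⟨δ, hδ, fun z hz => min_eq_right_iff.1 (heq hz)⟩

theorem isInvertibleLinfty_iff_isBoundedBelowOnDisk (hu : ContinuousOn u disk) {M : ℝ}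
    (hM : ∀ z ∈ disk, |u z| ≤ M) : IsInvertibleLinfty u ↔ IsBoundedBelowOnDisk u := by
  constructor
  · rintro ⟨-, v, hv, huv⟩
    have hK : 0 < lpNorm v ∞ dA + 1 := add_pos_of_nonneg_of_pos lpNorm_nonneg one_pos
    refine .of_ae_le hu (inv_pos.2 hK) ?_
    filter_upwards [huv, ae_le_lpNorm_exponent_top hv] with z hz hvz
    rw [inv_le_iff_one_le_mul₀ hK]
    calc 1 = |u z| * |v z| := by rw [← abs_mul, hz, abs_one]
      _ ≤ |u z| * (lpNorm v ∞ dA + 1) := by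
          gcongr
          exact hvz.trans (le_add_of_nonneg_right zero_le_one)
  · rintro ⟨δ, hδ, h⟩
    have hne : ∀ z ∈ disk, u z ≠ 0 := fun z hz => abs_pos.1 (hδ.trans_le (h z hz))
    refine ⟨memLp_top_of_bound (aestronglyMeasurable_of_continuousOn_disk hu) M
      (ae_mem_disk.mono hM), fun z => (u z)⁻¹, ?_,
      ae_mem_disk.mono fun z hz => mul_inv_cancel₀ (hne z hz)⟩
    refine memLp_top_of_bound (aestronglyMeasurable_of_continuousOn_disk (hu.inv₀ hne)) δ⁻¹
      (ae_mem_disk.mono fun z hz => ?_)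
    rw [norm_inv, Real.norm_eq_abs]
    exact inv_anti₀ hδ (h z hz)

end BoundedBelow

section Mobius

/-- The involutive automorphism of the disk that exchanges `0` and `z`. -/
def mobius (z u : ℂ) : ℂ := (z - u) / (1 - conj z * u)

/-- The Berezin kernel `|k_z(w)|²` in closed form. It is also the real Jacobian of `mobius z`
at `w`. -/
def berezinKernel (z w : ℂ) : ℝ := (1 - ‖z‖ ^ 2) ^ 2 / ‖1 - conj z * w‖ ^ 4

variable {z u : ℂ}

theorem one_sub_norm_sq_pos (hz : z ∈ disk) : 0 < 1 - ‖z‖ ^ 2 := by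
  have := mem_disk.1 hz
  nlinarith [norm_nonneg z]

theorem norm_one_sub_conj_mul_comm (z u : ℂ) : ‖1 - conj z * u‖ = ‖1 - conj u * z‖ := by
  rw [← RCLike.norm_conj]
  simp [mul_comm]

theorem one_sub_norm_right_le (hz : z ∈ disk) : 1 - ‖u‖ ≤ ‖1 - conj z * u‖ := by
  have h := norm_sub_norm_le (1 : ℂ) (conj z * u)
  rw [norm_one, norm_mul, RCLike.norm_conj] at h
  nlinarith [norm_nonneg u, mem_disk.1 hz]

theorem one_sub_norm_left_le (hu : u ∈ disk) : 1 - ‖z‖ ≤ ‖1 - conj z * u‖ :=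
  norm_one_sub_conj_mul_comm z u ▸ one_sub_norm_right_le hu

theorem norm_one_sub_conj_mul_pos (hz : z ∈ disk) (hu : u ∈ disk) : 0 < ‖1 - conj z * u‖ := by
  linarith [mem_disk.1 hu, one_sub_norm_right_le (u := u) hz]

theorem one_sub_conj_mul_ne_zero (hz : z ∈ disk) (hu : u ∈ disk) : 1 - conj z * u ≠ 0 :=
  norm_pos_iff.1 (norm_one_sub_conj_mul_pos hz hu)

theorem norm_one_sub_conj_mul_sq (z u : ℂ) :
    ‖1 - conj z * u‖ ^ 2 = ‖z - u‖ ^ 2 + (1 - ‖z‖ ^ 2) * (1 - ‖u‖ ^ 2) := by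
  simp only [← Complex.normSq_eq_norm_sq, Complex.normSq_apply, Complex.sub_re, Complex.sub_im,
    Complex.mul_re, Complex.mul_im, Complex.conj_re, Complex.conj_im, Complex.one_re,
    Complex.one_im]
  ring

theorem norm_one_sub_conj_mul_self (hz : z ∈ disk) : ‖1 - conj z * z‖ = 1 - ‖z‖ ^ 2 := by
  have h := norm_one_sub_conj_mul_sq z z
  rw [sub_self, norm_zero] at h
  exact (pow_left_inj₀ (norm_nonneg _) (one_sub_norm_sq_pos hz).le two_ne_zero).1 (by linarith)

theorem one_sub_norm_mobius_sq (hz : z ∈ disk) (hu : u ∈ disk) :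
    1 - ‖mobius z u‖ ^ 2 = (1 - ‖z‖ ^ 2) * (1 - ‖u‖ ^ 2) / ‖1 - conj z * u‖ ^ 2 := by
  have h := norm_one_sub_conj_mul_pos hz hu
  rw [mobius, norm_div, div_pow, eq_div_iff (by positivity), sub_mul,
    div_mul_cancel₀ _ (by positivity), norm_one_sub_conj_mul_sq]
  ring

theorem mobius_mem_disk (hz : z ∈ disk) (hu : u ∈ disk) : mobius z u ∈ disk := by
  have h : 0 < 1 - ‖mobius z u‖ ^ 2 := by
    rw [one_sub_norm_mobius_sq hz hu]
    have := norm_one_sub_conj_mul_pos hz hu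
    have := one_sub_norm_sq_pos hz
    have := one_sub_norm_sq_pos hu
    positivity
  rw [mem_disk]
  nlinarith [norm_nonneg (mobius z u)]

theorem one_sub_conj_mul_mobius (hz : z ∈ disk) (hu : u ∈ disk) :
    1 - conj z * mobius z u = (1 - conj z * z) / (1 - conj z * u) := by
  have := one_sub_conj_mul_ne_zero hz hu
  rw [mobius]
  field_simp
  ring

theorem mobius_mobius (hz : z ∈ disk) (hu : u ∈ disk) : mobius z (mobius z u) = u := by
  rw [mobius, one_sub_conj_mul_mobius hz hu, mobius, div_div_eq_mul_div,
    div_eq_iff (one_sub_conj_mul_ne_zero hz hz), sub_mul,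
    div_mul_cancel₀ _ (one_sub_conj_mul_ne_zero hz hu)]
  ring

theorem mobius_zero (z : ℂ) : mobius z 0 = z := by simp [mobius]

theorem rho_eq_norm_mobius (z w : ℂ) : rho z w = ‖mobius z w‖ := by
  rw [rho, mobius, norm_div, norm_div, norm_sub_rev, ← norm_one_sub_conj_mul_comm]

theorem hasDerivAt_mobius (hz : z ∈ disk) (hu : u ∈ disk) :
    HasDerivAt (mobius z) (-(1 - conj z * z) / (1 - conj z * u) ^ 2) u := by
  have hnum : HasDerivAt (fun u => z - u) (-1) u := (hasDerivAt_id u).const_sub z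
  have hden : HasDerivAt (fun u => 1 - conj z * u) (-(conj z * 1)) u :=
    ((hasDerivAt_id u).const_mul (conj z)).const_sub 1
  refine (hnum.div hden (one_sub_conj_mul_ne_zero hz hu)).congr_deriv ?_
  congr 1
  ring

theorem differentiableOn_mobius (hz : z ∈ disk) : DifferentiableOn ℂ (mobius z) disk :=
  fun _ hu => (hasDerivAt_mobius hz hu).differentiableAt.differentiableWithinAt

theorem measurable_mobius (z : ℂ) : Measurable (mobius z) := by
  unfold mobius
  fun_prop

theorem mobius_image (hz : z ∈ disk) {S : Set ℂ} (hS : S ⊆ disk) :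
    mobius z '' S = disk ∩ mobius z ⁻¹' S := by
  ext w
  constructor
  · rintro ⟨u, hu, rfl⟩
    exact ⟨mobius_mem_disk hz (hS hu), by rwa [mem_preimage, mobius_mobius hz (hS hu)]⟩
  · rintro ⟨hw, hwS⟩
    exact ⟨mobius z w, hwS, mobius_mobius hz hw⟩

theorem mobius_image_mobius_image (hz : z ∈ disk) {S : Set ℂ} (hS : S ⊆ disk) :
    mobius z '' (mobius z '' S) = S := by
  rw [image_image]
  exact (image_congr fun u hu => mobius_mobius hz (hS hu)).trans (image_id' S)

theorem mobius_image_disk (hz : z ∈ disk) : mobius z '' disk = disk := by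
  rw [mobius_image hz Subset.rfl]
  exact inter_eq_left.2 fun _ => mobius_mem_disk hz

theorem measurableSet_mobius_image (hz : z ∈ disk) {S : Set ℂ} (hS : MeasurableSet S)
    (hSd : S ⊆ disk) : MeasurableSet (mobius z '' S) :=
  mobius_image hz hSd ▸ measurableSet_disk.inter (measurable_mobius z hS)

theorem ball_zero_subset_disk {r : ℝ} (hr : r ≤ 1) : ball (0 : ℂ) r ⊆ disk := ball_subset_ball hr

theorem pseudoDisk_eq_image (hz : z ∈ disk) {r : ℝ} (hr : r ≤ 1) :
    pseudoDisk z r = mobius z '' ball 0 r := by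
  rw [mobius_image hz (ball_zero_subset_disk hr)]
  ext w
  rw [pseudoDisk, mem_inter_iff, mem_preimage, mem_ball_zero_iff, mem_ofPred_eq,
    rho_eq_norm_mobius]

theorem pseudoDisk_inter (hz : z ∈ disk) {r : ℝ} (hr : r ≤ 1) (G : Set ℂ) :
    pseudoDisk z r ∩ G = mobius z '' (ball 0 r ∩ mobius z ⁻¹' G) := by
  rw [pseudoDisk_eq_image hz hr, ← image_inter_preimage]

theorem disk_sdiff_pseudoDisk (hz : z ∈ disk) {r : ℝ} (hr : r ≤ 1) :
    disk \ pseudoDisk z r = mobius z '' (disk \ ball 0 r) := by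
  rw [mobius_image hz sdiff_subset, pseudoDisk_eq_image hz hr,
    mobius_image hz (ball_zero_subset_disk hr)]
  ext w
  simp only [Set.mem_sdiff, mem_inter_iff, mem_preimage]
  exact ⟨fun h => ⟨h.1, mobius_mem_disk hz h.1, fun hw => h.2 ⟨h.1, hw⟩⟩,
    fun h => ⟨h.1, fun hw => h.2.2 hw.2⟩⟩

theorem measurableSet_pseudoDisk (hz : z ∈ disk) {r : ℝ} (hr : r ≤ 1) :
    MeasurableSet (pseudoDisk z r) :=
  pseudoDisk_eq_image hz hr ▸
    measurableSet_mobius_image hz measurableSet_ball (ball_zero_subset_disk hr)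

theorem berezinKernel_nonneg (z w : ℂ) : 0 ≤ berezinKernel z w := by
  unfold berezinKernel
  positivity

theorem measurable_berezinKernel (z : ℂ) : Measurable (berezinKernel z) := by
  unfold berezinKernel
  fun_prop

theorem norm_deriv_mobius_sq (hz : z ∈ disk) (u : ℂ) :
    ‖-(1 - conj z * z) / (1 - conj z * u) ^ 2‖ ^ 2 = berezinKernel z u := by
  rw [norm_div, norm_neg, norm_one_sub_conj_mul_self hz, norm_pow, div_pow, berezinKernel]
  ring

theorem berezinKernel_mul_berezinKernel_mobius (hz : z ∈ disk) (hu : u ∈ disk) :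
    berezinKernel z u * berezinKernel z (mobius z u) = 1 := by
  have := norm_one_sub_conj_mul_pos hz hu
  have := one_sub_norm_sq_pos hz
  rw [berezinKernel, berezinKernel, one_sub_conj_mul_mobius hz hu, norm_div,
    norm_one_sub_conj_mul_self hz]
  field_simp

theorem berezinKernel_le_div_one_sub_norm (hz : z ∈ disk) (hu : u ∈ disk) :
    berezinKernel z u ≤ (1 - ‖z‖ ^ 2) ^ 2 / (1 - ‖u‖) ^ 4 := by
  have := sub_pos.2 (mem_disk.1 hu)
  unfold berezinKernel
  gcongr
  exact one_sub_norm_right_le hz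

theorem berezinKernel_le (hz : z ∈ disk) (hu : u ∈ disk) :
    berezinKernel z u ≤ 16 / (1 - ‖z‖ ^ 2) ^ 2 := by
  have ha := one_sub_norm_sq_pos hz
  have hle : 1 - ‖z‖ ^ 2 ≤ 2 * ‖1 - conj z * u‖ := by
    nlinarith [one_sub_norm_left_le (z := z) hu, mem_disk.1 hz, norm_nonneg z]
  have := norm_one_sub_conj_mul_pos hz hu
  rw [berezinKernel, div_le_div_iff₀ (by positivity) (by positivity)]
  calc (1 - ‖z‖ ^ 2) ^ 2 * (1 - ‖z‖ ^ 2) ^ 2 = (1 - ‖z‖ ^ 2) ^ 4 := by ring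
    _ ≤ (2 * ‖1 - conj z * u‖) ^ 4 := by gcongr
    _ = 16 * ‖1 - conj z * u‖ ^ 4 := by ring

theorem le_berezinKernel_of_mem_pseudoDisk (hz : z ∈ disk) {r : ℝ} (hr : r < 1) {w : ℂ}
    (hw : w ∈ pseudoDisk z r) : (1 - r) ^ 4 / (1 - ‖z‖ ^ 2) ^ 2 ≤ berezinKernel z w := by
  obtain ⟨u, hu, rfl⟩ := pseudoDisk_eq_image hz hr.le ▸ hw
  have hud := ball_zero_subset_disk hr.le hu
  have hur := mem_ball_zero_iff.1 hu
  have ha := one_sub_norm_sq_pos hz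
  have : 0 < 1 - r := sub_pos.2 hr
  have hle : berezinKernel z u ≤ (1 - ‖z‖ ^ 2) ^ 2 / (1 - r) ^ 4 :=
    (berezinKernel_le_div_one_sub_norm hz hud).trans (by gcongr)
  have hpos : 0 < berezinKernel z u :=
    (berezinKernel_nonneg z u).lt_of_ne fun h => by
      simpa [← h] using berezinKernel_mul_berezinKernel_mobius hz hud
  rw [eq_inv_of_mul_eq_one_right (berezinKernel_mul_berezinKernel_mobius hz hud), ← inv_div]
  exact inv_anti₀ hpos hle

end Mobius

section ChangeOfVariables

theorem abs_det_restrictScalars_toSpanSingleton (c : ℂ) :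
    |((ContinuousLinearMap.toSpanSingleton ℂ c).restrictScalars ℝ).det| = ‖c‖ ^ 2 := by
  have h : ((ContinuousLinearMap.toSpanSingleton ℂ c).restrictScalars ℝ).det = ‖c‖ ^ 2 := by
    simp [ContinuousLinearMap.det, LinearMap.det_restrictScalars, Algebra.norm_complex_apply,
      Complex.normSq_eq_norm_sq]
  rw [h, abs_of_nonneg (by positivity)]

theorem setLIntegral_image_of_hasDerivAt {p p' : ℂ → ℂ} {s : Set ℂ} (hs : MeasurableSet s)
    (hp : ∀ u ∈ s, HasDerivAt p (p' u) u) (hinj : InjOn p s) (h : ℂ → ℝ≥0∞) :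
    ∫⁻ w in p '' s, h w = ∫⁻ u in s, ENNReal.ofReal (‖p' u‖ ^ 2) * h (p u) := by
  rw [lintegral_image_eq_lintegral_abs_det_fderiv_mul volume hs
    (f' := fun u => (ContinuousLinearMap.toSpanSingleton ℂ (p' u)).restrictScalars ℝ)
    (fun u hu => ((hp u hu).hasFDerivAt.restrictScalars ℝ).hasFDerivWithinAt) hinj h]
  simp only [abs_det_restrictScalars_toSpanSingleton]

theorem restrict_dA {S : Set ℂ} (hS : S ⊆ disk) :
    dA.restrict S = (ENNReal.ofReal π)⁻¹ • volume.restrict S := by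
  rw [dA, Measure.restrict_smul, Measure.restrict_restrict_of_subset hS]

theorem setLIntegral_dA {S : Set ℂ} (hS : S ⊆ disk) (h : ℂ → ℝ≥0∞) :
    ∫⁻ w in S, h w ∂dA = (ENNReal.ofReal π)⁻¹ * ∫⁻ w in S, h w := by
  rw [restrict_dA hS, lintegral_smul_measure, smul_eq_mul]

theorem dA_real_eq_div {S : Set ℂ} (hS : S ⊆ disk) : dA.real S = volume.real S / π := by
  rw [Measure.real, ← Measure.restrict_apply_self, restrict_dA hS, Measure.smul_apply,
    Measure.restrict_apply_self, smul_eq_mul, ENNReal.toReal_mul, ENNReal.toReal_inv,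
    ENNReal.toReal_ofReal Real.pi_pos.le, Measure.real, div_eq_inv_mul]

theorem volume_real_ball {c : ℂ} {r : ℝ} (hr : 0 ≤ r) : volume.real (ball c r) = π * r ^ 2 := by
  rw [Measure.real, Complex.volume_ball, ENNReal.toReal_mul, ENNReal.toReal_pow,
    ENNReal.toReal_ofReal hr, ENNReal.coe_toReal, NNReal.coe_real_pi, mul_comm]

theorem dA_real_ball {c : ℂ} {r : ℝ} (hr₀ : 0 ≤ r) (hr : ball c r ⊆ disk) :
    dA.real (ball c r) = r ^ 2 := by
  rw [dA_real_eq_div hr, volume_real_ball hr₀,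
    mul_div_cancel_left₀ _ Real.pi_ne_zero]

variable {z : ℂ} {S : Set ℂ}

theorem setLIntegral_comp_mobius (hz : z ∈ disk) (hS : MeasurableSet S) (hSd : S ⊆ disk)
    (h : ℂ → ℝ≥0∞) :
    ∫⁻ u in S, h (mobius z u) ∂dA =
      ∫⁻ w in mobius z '' S, ENNReal.ofReal (berezinKernel z w) * h w ∂dA := by
  have himage : mobius z '' S ⊆ disk := mobius_image hz hSd ▸ inter_subset_left
  have hmeas := measurableSet_mobius_image hz hS hSd
  have hinj : InjOn (mobius z) (mobius z '' S) := fun u hu v hv huv => by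
    rw [← mobius_mobius hz (himage hu), huv, mobius_mobius hz (himage hv)]
  have hcov := setLIntegral_image_of_hasDerivAt hmeas
    (fun w hw => hasDerivAt_mobius hz (himage hw)) hinj fun u => h (mobius z u)
  rw [mobius_image_mobius_image hz hSd] at hcov
  rw [setLIntegral_dA hSd, setLIntegral_dA himage, hcov]
  congr 1
  refine setLIntegral_congr_fun hmeas fun w hw => ?_
  simp only [norm_deriv_mobius_sq hz, mobius_mobius hz (himage hw)]

theorem lintegral_comp_mobius (hz : z ∈ disk) (h : ℂ → ℝ≥0∞) :
    ∫⁻ u, h (mobius z u) ∂dA = ∫⁻ w, ENNReal.ofReal (berezinKernel z w) * h w ∂dA := by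
  simpa only [mobius_image_disk hz, restrict_disk_dA] using
    setLIntegral_comp_mobius hz measurableSet_disk Subset.rfl h

theorem dA_real_eq_setIntegral_berezinKernel (hz : z ∈ disk) (hS : MeasurableSet S)
    (hSd : S ⊆ disk) : dA.real S = ∫ w in mobius z '' S, berezinKernel z w ∂dA := by
  rw [integral_eq_lintegral_of_nonneg_ae (ae_of_all _ (berezinKernel_nonneg z))
    (measurable_berezinKernel z).aestronglyMeasurable]
  have h := setLIntegral_comp_mobius hz hS hSd fun _ => 1
  simp only [mul_one, setLIntegral_one] at h
  rw [← h, Measure.real]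

theorem integral_berezinKernel (hz : z ∈ disk) : ∫ w, berezinKernel z w ∂dA = 1 := by
  have h := dA_real_eq_setIntegral_berezinKernel hz measurableSet_disk Subset.rfl
  rw [mobius_image_disk hz, restrict_disk_dA] at h
  rw [← h, disk, dA_real_ball zero_le_one (ball_zero_subset_disk le_rfl), one_pow]

theorem integrable_berezinKernel (hz : z ∈ disk) : Integrable (berezinKernel z) dA :=
  .of_integral_ne_zero (integral_berezinKernel hz ▸ one_ne_zero)

theorem dA_real_le_mul_dA_real_mobius_image (hz : z ∈ disk) (hS : MeasurableSet S)
    (hSd : S ⊆ disk) : dA.real S ≤ 16 / (1 - ‖z‖ ^ 2) ^ 2 * dA.real (mobius z '' S) := by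
  rw [dA_real_eq_setIntegral_berezinKernel hz hS hSd, mul_comm, ← smul_eq_mul,
    ← setIntegral_const]
  exact setIntegral_mono_on (integrable_berezinKernel hz).integrableOn (integrable_const _)
    (measurableSet_mobius_image hz hS hSd)
    fun w hw => berezinKernel_le hz (mobius_image hz hSd ▸ hw).1

theorem mul_dA_real_mobius_image_le (hz : z ∈ disk) {r : ℝ} (hr : r < 1) (hS : MeasurableSet S)
    (hSr : S ⊆ ball 0 r) :
    (1 - r) ^ 4 / (1 - ‖z‖ ^ 2) ^ 2 * dA.real (mobius z '' S) ≤ dA.real S := by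
  have hSd := hSr.trans (ball_zero_subset_disk hr.le)
  rw [dA_real_eq_setIntegral_berezinKernel hz hS hSd, mul_comm, ← smul_eq_mul,
    ← setIntegral_const]
  refine setIntegral_mono_on (integrable_const _) (integrable_berezinKernel hz).integrableOn
    (measurableSet_mobius_image hz hS hSd) fun w hw => ?_
  exact le_berezinKernel_of_mem_pseudoDisk hz hr (pseudoDisk_eq_image hz hr.le ▸ image_mono hSr hw)

end ChangeOfVariables

section BerezinTransform

theorem norm_normalizedKernel_sq {z : ℂ} (hz : z ∈ disk) (w : ℂ) :
    ‖normalizedKernel z w‖ ^ 2 = berezinKernel z w := by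
  have ha := one_sub_norm_sq_pos hz
  have hkernel (v : ℂ) : ‖kernel z v‖ ^ 2 = ((1 - ‖z‖ ^ 2) ^ 2)⁻¹ * berezinKernel z v := by
    rw [kernel, berezinKernel, norm_div, norm_one, norm_pow]
    field_simp
  have hint : ∫ v, ‖kernel z v‖ ^ 2 ∂dA = ((1 - ‖z‖ ^ 2) ^ 2)⁻¹ := by
    simp only [hkernel]
    rw [integral_const_mul, integral_berezinKernel hz, mul_one]
  rw [normalizedKernel, hint, norm_div, div_pow, hkernel, Complex.norm_real,
    Real.norm_eq_abs, sq_abs, Real.sq_sqrt (by positivity)]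
  field_simp

theorem isBergman_normalizedKernel {z : ℂ} (hz : z ∈ disk) : IsBergman (normalizedKernel z) := by
  have hdiff : DifferentiableOn ℂ (normalizedKernel z) disk := by
    unfold normalizedKernel kernel
    exact .div_const (.div (by fun_prop) (by fun_prop)
      fun w hw => pow_ne_zero _ (one_sub_conj_mul_ne_zero hz hw)) _
  refine ⟨hdiff, (memLp_two_iff_integrable_sq_norm
    (aestronglyMeasurable_of_continuousOn_disk hdiff.continuousOn)).2 ?_⟩
  simp only [norm_normalizedKernel_sq hz]
  exact integrable_berezinKernel hz

variable {μ : Measure ℂ} {z : ℂ}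

theorem berezin_eq (hz : z ∈ disk) : berezin μ z = ∫ w in disk, berezinKernel z w ∂μ := by
  simp only [berezin, norm_normalizedKernel_sq hz]

theorem berezin_nonneg (μ : Measure ℂ) (z : ℂ) : 0 ≤ berezin μ z :=
  integral_nonneg fun _ => sq_nonneg _

theorem integrableOn_berezinKernel [IsFiniteMeasure μ] (hz : z ∈ disk) :
    IntegrableOn (berezinKernel z) disk μ := by
  refine .of_bound (measure_lt_top μ disk) (measurable_berezinKernel z).aestronglyMeasurable
    (16 / (1 - ‖z‖ ^ 2) ^ 2) ?_
  filter_upwards [ae_restrict_mem measurableSet_disk] with w hw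
  rw [Real.norm_of_nonneg (berezinKernel_nonneg z w)]
  exact berezinKernel_le hz hw

theorem continuousOn_berezin (μ : Measure ℂ) [IsFiniteMeasure μ] :
    ContinuousOn (berezin μ) disk := by
  refine ContinuousOn.congr (fun z hz => ContinuousAt.continuousWithinAt ?_)
    fun z hz => berezin_eq hz
  have hbound : ContinuousAt (fun x : ℂ => 16 / (1 - ‖x‖ ^ 2) ^ 2) z :=
    continuousAt_const.div (by fun_prop) (pow_pos (one_sub_norm_sq_pos hz) 2).ne'
  refine continuousAt_of_dominated (bound := fun _ => 16 / (1 - ‖z‖ ^ 2) ^ 2 + 1)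
    (.of_forall fun x => (measurable_berezinKernel x).aestronglyMeasurable) ?_
    (integrable_const _) ?_
  · filter_upwards [isOpen_disk.mem_nhds hz, hbound.eventually_lt_const (lt_add_one _)]
      with x hx hxz
    filter_upwards [ae_restrict_mem measurableSet_disk] with w hw
    rw [Real.norm_of_nonneg (berezinKernel_nonneg x w)]
    exact (berezinKernel_le hx hw).trans hxz.le
  · filter_upwards [ae_restrict_mem measurableSet_disk] with w hw
    unfold berezinKernel
    exact ContinuousAt.div (by fun_prop) (by fun_prop)
      (pow_pos (norm_one_sub_conj_mul_pos hz hw) 4).ne'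

theorem IsReverseCarleson.isBoundedBelowOnDisk_berezin [IsFiniteMeasure μ]
    (h : IsReverseCarleson μ) : IsBoundedBelowOnDisk (berezin μ) := by
  obtain ⟨C, hC, h⟩ := h
  refine ⟨C, hC, fun z hz => ?_⟩
  have hnorm {ν : Measure ℂ} [IsFiniteMeasure ν] :
      ∫⁻ w in disk, ‖normalizedKernel z w‖ₑ ^ 2 ∂ν = ENNReal.ofReal (berezin ν z) := by
    rw [berezin_eq hz, ofReal_integral_eq_lintegral_ofReal (integrableOn_berezinKernel hz)
      (ae_of_all _ (berezinKernel_nonneg z))]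
    simp only [← norm_normalizedKernel_sq hz, ofReal_norm_sq]
  have hk := h _ (isBergman_normalizedKernel hz)
  rw [hnorm, hnorm, berezin_eq (μ := dA) hz, restrict_disk_dA, integral_berezinKernel hz,
    ENNReal.ofReal_one, mul_one, ENNReal.ofReal_le_ofReal_iff (berezin_nonneg μ z)] at hk
  exact hk.trans (le_abs_self _)

end BerezinTransform

section DominatedMeasure

variable {μ : Measure ℂ} {M : ℝ≥0} {z : ℂ} {r : ℝ}

theorem measureReal_le_of_le_smul (hμ : μ ≤ M • dA) (S : Set ℂ) : μ.real S ≤ M * dA.real S := by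
  simpa [Measure.real] using ENNReal.toReal_mono (measure_ne_top (M • dA) S) (hμ S)

theorem setIntegral_berezinKernel_le_of_le_smul (hμ : μ ≤ M • dA) (hz : z ∈ disk) (S : Set ℂ) :
    ∫ w in S, berezinKernel z w ∂μ ≤ M * ∫ w in S, berezinKernel z w ∂dA := by
  refine (integral_mono_measure (Measure.restrict_mono_measure hμ S)
    (ae_of_all _ (berezinKernel_nonneg z)) ?_).trans_eq ?_
  · rw [Measure.restrict_smul]
    exact (integrable_berezinKernel hz).integrableOn.smul_measure_nnreal
  · rw [Measure.restrict_smul, integral_smul_nnreal_measure, NNReal.smul_def, smul_eq_mul]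

theorem berezin_le_of_le_smul (hμ : μ ≤ M • dA) (hz : z ∈ disk) : berezin μ z ≤ M := by
  rw [berezin_eq hz]
  simpa only [restrict_disk_dA, integral_berezinKernel hz, mul_one] using
    setIntegral_berezinKernel_le_of_le_smul hμ hz disk

theorem dA_real_pseudoDisk_pos (hz : z ∈ disk) (hr₀ : 0 < r) (hr : r ≤ 1) :
    0 < dA.real (pseudoDisk z r) := by
  have h := dA_real_le_mul_dA_real_mobius_image hz measurableSet_ball (ball_zero_subset_disk hr)
  rw [dA_real_ball hr₀.le (ball_zero_subset_disk hr), ← pseudoDisk_eq_image hz hr] at h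
  exact pos_of_mul_pos_right ((pow_pos hr₀ 2).trans_le h) (by positivity)

theorem mul_dA_real_pseudoDisk_le_one (hz : z ∈ disk) (hr : r < 1) :
    (1 - r) ^ 4 / (1 - ‖z‖ ^ 2) ^ 2 * dA.real (pseudoDisk z r) ≤ 1 := by
  rw [pseudoDisk_eq_image hz hr.le]
  exact (mul_dA_real_mobius_image_le hz hr measurableSet_ball Subset.rfl).trans measureReal_le_one

theorem setIntegral_berezinKernel_disk_sdiff_pseudoDisk (hz : z ∈ disk) (hr₀ : 0 ≤ r)
    (hr : r ≤ 1) : ∫ w in disk \ pseudoDisk z r, berezinKernel z w ∂dA = 1 - r ^ 2 := by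
  rw [disk_sdiff_pseudoDisk hz hr, ← dA_real_eq_setIntegral_berezinKernel hz
    (measurableSet_disk.diff measurableSet_ball) sdiff_subset,
    measureReal_sdiff (ball_zero_subset_disk hr) measurableSet_ball,
    dA_real_ball hr₀ (ball_zero_subset_disk hr), disk,
    dA_real_ball zero_le_one (ball_zero_subset_disk le_rfl), one_pow]

theorem berezin_le_add_of_le_smul [IsFiniteMeasure μ] (hμ : μ ≤ M • dA) (hz : z ∈ disk)
    (hr₀ : 0 ≤ r) (hr : r ≤ 1) :
    berezin μ z ≤ 16 / (1 - ‖z‖ ^ 2) ^ 2 * μ.real (pseudoDisk z r) + M * (1 - r ^ 2) := by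
  have hsub : pseudoDisk z r ⊆ disk := fun w hw => hw.1
  have hE := measurableSet_pseudoDisk hz hr
  have hint : IntegrableOn (berezinKernel z) disk μ := integrableOn_berezinKernel hz
  calc berezin μ z = ∫ w in pseudoDisk z r, berezinKernel z w ∂μ +
        ∫ w in disk \ pseudoDisk z r, berezinKernel z w ∂μ := by
        rw [berezin_eq hz, setIntegral_sdiff hE hint hsub, add_sub_cancel]
    _ ≤ 16 / (1 - ‖z‖ ^ 2) ^ 2 * μ.real (pseudoDisk z r) + M * (1 - r ^ 2) := by
        gcongr
        · rw [mul_comm, ← smul_eq_mul, ← setIntegral_const]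
          exact setIntegral_mono_on (hint.mono_set hsub) (integrable_const _) hE
            fun w hw => berezinKernel_le hz hw.1
        · rw [← setIntegral_berezinKernel_disk_sdiff_pseudoDisk hz hr₀ hr]
          exact setIntegral_berezinKernel_le_of_le_smul hμ hz _

theorem reverseCarlesonCondition_iff_of_le_smul (hμ : μ ≤ M • dA) :
    ReverseCarlesonCondition μ ↔ ∃ r : ℝ, 0 < r ∧ r < 1 ∧ ∃ c : ℝ, 0 < c ∧ ∀ z ∈ disk,
      c * dA.real (pseudoDisk z r) ≤ μ.real (pseudoDisk z r) := by
  refine exists_congr fun r => and_congr_right fun hr₀ => and_congr_right fun hr => ?_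
  constructor
  · rintro ⟨C, hC, h⟩
    exact ⟨C⁻¹, inv_pos.2 hC, fun z hz =>
      (le_div_iff₀ (dA_real_pseudoDisk_pos hz hr₀ hr.le)).1 (h z hz).1⟩
  · rintro ⟨c, hc, h⟩
    refine ⟨max c⁻¹ M, lt_max_of_lt_left (inv_pos.2 hc), fun z hz => ?_⟩
    have hpos := dA_real_pseudoDisk_pos hz hr₀ hr.le
    rw [le_div_iff₀ hpos, div_le_iff₀ hpos]
    constructor
    · refine le_trans ?_ (h z hz)
      gcongr
      exact inv_le_of_inv_le₀ hc (le_max_left _ _)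
    · refine (measureReal_le_of_le_smul hμ _).trans ?_
      gcongr
      exact le_max_right _ _

theorem exists_mul_one_sub_sq_le (M : ℝ) {ε : ℝ} (hε : 0 < ε) :
    ∃ r : ℝ, 0 < r ∧ r < 1 ∧ M * (1 - r ^ 2) ≤ ε := by
  have htendsto : Tendsto (fun r : ℝ => M * (1 - r ^ 2)) (𝓝[<] 1) (𝓝 (M * (1 - 1 ^ 2))) :=
    (Continuous.tendsto (by fun_prop) _).mono_left nhdsWithin_le_nhds
  obtain ⟨r, hle, hr⟩ := ((htendsto.eventually_lt_const (by simpa using hε)).and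
    (Ioo_mem_nhdsLT (zero_lt_one' ℝ))).exists
  exact ⟨r, hr.1, hr.2, hle.le⟩

theorem IsBoundedBelowOnDisk.reverseCarlesonCondition [IsFiniteMeasure μ] (hμ : μ ≤ M • dA)
    (h : IsBoundedBelowOnDisk (berezin μ)) : ReverseCarlesonCondition μ := by
  obtain ⟨δ, hδ, h⟩ := h
  obtain ⟨r, hr₀, hr, hM⟩ := exists_mul_one_sub_sq_le M (half_pos hδ)
  have : 0 < 1 - r := sub_pos.2 hr
  refine (reverseCarlesonCondition_iff_of_le_smul hμ).2
    ⟨r, hr₀, hr, δ * (1 - r) ^ 4 / 32, by positivity, fun z hz => ?_⟩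
  have ha := one_sub_norm_sq_pos hz
  have hδz : δ / 2 ≤ 16 / (1 - ‖z‖ ^ 2) ^ 2 * μ.real (pseudoDisk z r) := by
    have hle := berezin_le_add_of_le_smul hμ hz hr₀.le hr.le
    have := h z hz
    rw [abs_of_nonneg (berezin_nonneg μ z)] at this
    linarith
  calc δ * (1 - r) ^ 4 / 32 * dA.real (pseudoDisk z r)
      = (1 - ‖z‖ ^ 2) ^ 2 / 16 * (δ / 2) *
          ((1 - r) ^ 4 / (1 - ‖z‖ ^ 2) ^ 2 * dA.real (pseudoDisk z r)) := by
        field_simp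
        ring
    _ ≤ (1 - ‖z‖ ^ 2) ^ 2 / 16 * (16 / (1 - ‖z‖ ^ 2) ^ 2 * μ.real (pseudoDisk z r)) * 1 := by
        gcongr
        exact mul_dA_real_pseudoDisk_le_one hz hr
    _ = μ.real (pseudoDisk z r) := by field_simp

end DominatedMeasure

section MeasureOf

variable {φ : ℂ → ℝ} {t : ℝ}

theorem measureOf_le_smul (hφ : MemLp φ ∞ dA) :
    measureOf φ ≤ (lpNorm φ ∞ dA).toNNReal • dA := by
  refine (withDensity_mono (g := fun _ => ENNReal.ofReal (lpNorm φ ∞ dA)) ?_).trans_eq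
    (withDensity_const _)
  filter_upwards [ae_le_lpNorm_exponent_top hφ] with z hz
  exact ENNReal.ofReal_le_ofReal ((le_abs_self _).trans hz)

theorem isFiniteMeasure_measureOf (hφ : MemLp φ ∞ dA) : IsFiniteMeasure (measureOf φ) :=
  isFiniteMeasure_of_le _ (measureOf_le_smul hφ)

theorem nullMeasurableSet_superlevel (hφ : AEMeasurable φ dA) (t : ℝ) :
    NullMeasurableSet {z | z ∈ disk ∧ t < φ z} dA :=
  measurableSet_disk.nullMeasurableSet.inter (nullMeasurableSet_lt aemeasurable_const hφ)

theorem smul_charMeasure_superlevel_le (hφ : AEMeasurable φ dA) (t : ℝ) :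
    ENNReal.ofReal t • charMeasure {z | z ∈ disk ∧ t < φ z} ≤ measureOf φ := by
  rw [charMeasure, ← withDensity_const]
  refine (withDensity_mono ?_).trans
    ((restrict_withDensity' _ _).symm.trans_le Measure.restrict_le_self)
  filter_upwards [ae_restrict_mem₀ (nullMeasurableSet_superlevel hφ t)] with z hz
  exact ENNReal.ofReal_le_ofReal hz.2.le

theorem IsReverseCarleson.of_smul_le {μ ν : Measure ℂ} (hν : IsReverseCarleson ν) (ht : 0 < t)
    (h : ENNReal.ofReal t • ν ≤ μ) : IsReverseCarleson μ := by
  obtain ⟨C, hC, hν⟩ := hν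
  refine ⟨t * C, mul_pos ht hC, fun f hf => ?_⟩
  calc ENNReal.ofReal (t * C) * ∫⁻ z in disk, ‖f z‖ₑ ^ 2 ∂dA
      = ENNReal.ofReal t * (ENNReal.ofReal C * ∫⁻ z in disk, ‖f z‖ₑ ^ 2 ∂dA) := by
        rw [ENNReal.ofReal_mul ht.le, mul_assoc]
    _ ≤ ENNReal.ofReal t * ∫⁻ z in disk, ‖f z‖ₑ ^ 2 ∂ν := by
        gcongr
        exact hν f hf
    _ = ∫⁻ z in disk, ‖f z‖ₑ ^ 2 ∂(ENNReal.ofReal t • ν) := by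
        rw [Measure.restrict_smul, lintegral_smul_measure, smul_eq_mul]
    _ ≤ ∫⁻ z in disk, ‖f z‖ₑ ^ 2 ∂μ := lintegral_mono' (Measure.restrict_mono Subset.rfl h) le_rfl

theorem measureReal_measureOf_le (hφ : MemLp φ ∞ dA) (ht : 0 ≤ t) {S : Set ℂ} (hS : S ⊆ disk) :
    (measureOf φ).real S ≤
      lpNorm φ ∞ dA * dA.real (S ∩ {z | z ∈ disk ∧ t < φ z}) + t * dA.real S := by
  have := isFiniteMeasure_measureOf hφ
  set G := {z | z ∈ disk ∧ t < φ z}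
  have hG : NullMeasurableSet G dA := nullMeasurableSet_superlevel hφ.1.aemeasurable t
  have hle : measureOf φ ≤ (lpNorm φ ∞ dA).toNNReal • dA := measureOf_le_smul hφ
  rw [← measureReal_inter_add_sdiff₀ (hG.mono_ac (measureOf_absolutelyContinuous φ))]
  gcongr
  · exact (measureReal_le_of_le_smul hle _).trans_eq (by rw [Real.coe_toNNReal _ lpNorm_nonneg])
  · have hsdiff : measureOf φ (S \ G) ≤ ENNReal.ofReal t * dA (S \ G) := by
      rw [measureOf, withDensity_apply']
      exact (setLIntegral_mono measurable_const fun z hz => ENNReal.ofReal_le_ofReal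
        (not_lt.1 fun h => hz.2 ⟨hS hz.1, h⟩)).trans_eq (setLIntegral_const _ _)
    calc (measureOf φ).real (S \ G) ≤ (ENNReal.ofReal t * dA (S \ G)).toReal :=
          ENNReal.toReal_mono (by finiteness) hsdiff
      _ = t * dA.real (S \ G) := by rw [ENNReal.toReal_mul, ENNReal.toReal_ofReal ht, Measure.real]
      _ ≤ t * dA.real S := by gcongr; exacts [by finiteness, sdiff_subset]

end MeasureOf

section CircularMeans

theorem measurable_indicator_comp_of_continuousOn {X Y Z : Type*} [TopologicalSpace X]
    [MeasurableSpace X] [OpensMeasurableSpace X] [TopologicalSpace Y] [MeasurableSpace Y]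
    [BorelSpace Y] [MeasurableSpace Z] [Zero Z] {s : Set X} {g : X → Y} {h : Y → Z}
    (hg : ContinuousOn g s) (hs : MeasurableSet s) (hh : Measurable h) :
    Measurable (s.indicator (h ∘ g)) := by
  refine measurable_of_restrict_of_restrict_compl hs ?_ ?_
  · have heq : s.domRestrict (s.indicator (h ∘ g)) = h ∘ s.domRestrict g :=
      funext fun x => indicator_of_mem x.2 _
    exact heq ▸ hh.comp (continuousOn_iff_continuous_domRestrict.1 hg).measurable
  · have heq : sᶜ.domRestrict (s.indicator (h ∘ g)) = 0 :=
      funext fun x => indicator_of_notMem x.2 _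
    exact heq ▸ measurable_const

theorem polarCoord_symm_eq_circleMap (ρ θ : ℝ) :
    Complex.polarCoord.symm (ρ, θ) = circleMap 0 ρ θ := by
  rw [Complex.polarCoord_symm_apply, circleMap_zero, Complex.exp_mul_I, ← Complex.ofReal_cos,
    ← Complex.ofReal_sin]

theorem setLIntegral_ball_zero {h : ℂ → ℝ≥0∞} {r : ℝ}
    (hh : Measurable ((ball 0 r).indicator h)) :
    ∫⁻ w in ball 0 r, h w =
      ∫⁻ ρ in Ioo 0 r, ENNReal.ofReal ρ * ∫⁻ θ in Ioo (-π) π, h (circleMap 0 ρ θ) := by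
  have hcircle (ρ : ℝ) : Measurable fun θ => (ball 0 r).indicator h (circleMap 0 ρ θ) :=
    hh.comp (continuous_circleMap 0 ρ).measurable
  have hpolar : Measurable fun p : ℝ × ℝ =>
      ENNReal.ofReal p.1 • (ball 0 r).indicator h (Complex.polarCoord.symm p) := by
    simp only [Complex.polarCoord_symm_apply, smul_eq_mul]
    exact (by fun_prop : Measurable fun p : ℝ × ℝ => ENNReal.ofReal p.1).mul
      (hh.comp (by fun_prop))
  rw [← lintegral_indicator measurableSet_ball, ← Complex.lintegral_comp_polarCoord_symm,
    polarCoord_target, Measure.volume_eq_prod, ← Measure.prod_restrict,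
    lintegral_prod _ hpolar.aemeasurable]
  simp only [polarCoord_symm_eq_circleMap, smul_eq_mul, lintegral_const_mul _ (hcircle _)]
  rw [← Iio_inter_Ioi (a := r), ← setLIntegral_indicator measurableSet_Iio]
  refine setLIntegral_congr_fun measurableSet_Ioi fun ρ hρ => ?_
  have hmem (θ : ℝ) : circleMap 0 ρ θ ∈ ball 0 r ↔ ρ < r := by
    rw [mem_ball_zero_iff, norm_circleMap_zero, abs_of_pos hρ]
  by_cases hρr : ρ < r
  · simp only [indicator_of_mem (mem_Iio.2 hρr), indicator_of_mem ((hmem _).2 hρr)]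
  · simp only [indicator_of_notMem (notMem_Iio.2 (not_lt.1 hρr)),
      indicator_of_notMem (mt (hmem _).1 hρr), lintegral_zero, mul_zero]

theorem setLIntegral_ball_zero_mono {h₁ h₂ : ℂ → ℝ≥0∞} {r : ℝ}
    (hh₁ : Measurable ((ball 0 r).indicator h₁)) (hh₂ : Measurable ((ball 0 r).indicator h₂))
    (h : ∀ ρ ∈ Ioo 0 r, ∫⁻ θ in Ioo (-π) π, h₁ (circleMap 0 ρ θ) ≤
      ∫⁻ θ in Ioo (-π) π, h₂ (circleMap 0 ρ θ)) :
    ∫⁻ w in ball 0 r, h₁ w ≤ ∫⁻ w in ball 0 r, h₂ w := by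
  rw [setLIntegral_ball_zero hh₁, setLIntegral_ball_zero hh₂]
  exact setLIntegral_mono' measurableSet_Ioo fun ρ hρ => mul_le_mul_right (h ρ hρ) _

theorem enorm_mul_volume_ball_zero_le {g : ℂ → ℂ} {r : ℝ} (hg : DifferentiableOn ℂ g (ball 0 r)) :
    ‖g 0‖ₑ * volume (ball (0 : ℂ) r) ≤ ∫⁻ w in ball 0 r, ‖g w‖ₑ := by
  rw [← setLIntegral_const]
  refine setLIntegral_ball_zero_mono (measurable_const.indicator measurableSet_ball)
    (measurable_indicator_comp_of_continuousOn hg.continuousOn measurableSet_ball measurable_enorm)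
    fun ρ hρ => ?_
  have h := circle_bound hρ.1 (hg.diffContOnCl_ball (closedBall_subset_ball hρ.2))
  simp only [polarCoord_symm_eq_circleMap] at h
  rwa [setLIntegral_const, Real.volume_Ioo, sub_neg_eq_add, ← two_mul, mul_comm]

theorem enorm_mul_volume_ball_le {g : ℂ → ℂ} {c : ℂ} {r : ℝ}
    (hg : DifferentiableOn ℂ g (ball c r)) :
    ‖g c‖ₑ * volume (ball c r) ≤ ∫⁻ w in ball c r, ‖g w‖ₑ := by
  have hpre : (c + ·) ⁻¹' ball c r = ball 0 r := by
    rw [preimage_add_ball, sub_self]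
  have h := enorm_mul_volume_ball_zero_le (g := fun w => g (c + w)) (r := r)
    (hg.comp (by fun_prop) hpre.ge)
  have hadd := measurePreserving_add_left (volume : Measure ℂ) c
  rwa [add_zero, ← hpre,
    hadd.setLIntegral_comp_preimage_emb (measurableEmbedding_addLeft c) (fun w => ‖g w‖ₑ),
    hadd.measure_preimage_emb (measurableEmbedding_addLeft c)] at h

end CircularMeans

section Jensen

theorem circleAverage_eq_setIntegral {E : Type*} [NormedAddCommGroup E] [NormedSpace ℝ E]
    (f : ℂ → E) (c : ℂ) (R : ℝ) :
    Real.circleAverage f c R = (2 * π)⁻¹ • ∫ θ in Ioo (-π) π, f (circleMap c R θ) := by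
  rw [Real.circleAverage_eq_integral_add (-π),
    intervalIntegral.integral_comp_add_right fun θ => f (circleMap c R θ), zero_add, two_mul,
    add_neg_cancel_right, intervalIntegral.integral_of_le (by linarith [Real.pi_pos]),
    integral_Ioc_eq_integral_Ioo]

theorem integrableOn_circleMap {E : Type*} [NormedAddCommGroup E] {f : ℂ → E} {c : ℂ} {R : ℝ}
    (hf : CircleIntegrable f c R) :
    IntegrableOn (fun θ => f (circleMap c R θ)) (Ioo (-π) π) := by
  have hper : Function.Periodic (fun θ => f (circleMap c R θ)) (2 * π) :=
    (periodic_circleMap c R).comp f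
  exact (intervalIntegrable_iff_integrableOn_Ioo_of_le (by linarith [Real.pi_pos])).1
    (hper.intervalIntegrable₀ (by positivity) hf (-π) π)

variable {g : ℂ → ℂ} {B r : ℝ}

theorem log_norm_le_circleAverage {ρ : ℝ} (hρ : 0 < ρ)
    (hg : AnalyticOnNhd ℂ g (closedBall 0 |ρ|)) (h0 : g 0 ≠ 0) :
    Real.log ‖g 0‖ ≤ Real.circleAverage (fun w => Real.log ‖g w‖) 0 ρ := by
  rw [hg.circleAverage_log_norm hρ.ne' h0]
  refine le_add_of_nonneg_left (finsum_nonneg fun u => ?_)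
  by_cases hu : u ∈ closedBall (0 : ℂ) |ρ|
  · refine mul_nonneg (mod_cast MeromorphicOn.AnalyticOnNhd.divisor_nonneg hg u) ?_
    rcases eq_or_ne u 0 with rfl | hu0
    · simp
    · rw [mem_closedBall_zero_iff, abs_of_pos hρ] at hu
      rw [zero_sub, norm_neg]
      exact Real.log_nonneg
        (by rwa [← div_eq_mul_inv, one_le_div (norm_pos_iff.2 hu0)])
  · simp [hu]

/- Here and below the zeros of `g` do no harm: there `log ‖g w‖ = 0 ≤ log B`. -/
theorem log_norm_le_log {w : ℂ} (hB : 1 ≤ B) (hw : ‖g w‖ ≤ B) : Real.log ‖g w‖ ≤ Real.log B := by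
  rcases (norm_nonneg (g w)).eq_or_lt with h | h
  · rw [← h, Real.log_zero]
    exact Real.log_nonneg hB
  · exact Real.log_le_log h hw

theorem lintegral_circleMap_log_sub_log_norm_le {ρ : ℝ} (hρ : 0 < ρ)
    (hg : AnalyticOnNhd ℂ g (closedBall 0 |ρ|)) (h0 : ‖g 0‖ = 1) (hB : 1 ≤ B)
    (hgB : ∀ w ∈ sphere 0 |ρ|, ‖g w‖ ≤ B) :
    ∫⁻ θ in Ioo (-π) π, ENNReal.ofReal (Real.log B - Real.log ‖g (circleMap 0 ρ θ)‖) ≤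
      ∫⁻ _ in Ioo (-π) π, ENNReal.ofReal (Real.log B) := by
  have hint : IntegrableOn (fun θ => Real.log ‖g (circleMap 0 ρ θ)‖) (Ioo (-π) π) :=
    integrableOn_circleMap (f := fun w => Real.log ‖g w‖)
      (hg.mono sphere_subset_closedBall).meromorphicOn.circleIntegrable_log_norm
  have hnonneg (θ : ℝ) : 0 ≤ Real.log B - Real.log ‖g (circleMap 0 ρ θ)‖ :=
    sub_nonneg.2 (log_norm_le_log hB (hgB _ (circleMap_mem_sphere' 0 ρ θ)))
  have havg : 0 ≤ ∫ θ in Ioo (-π) π, Real.log ‖g (circleMap 0 ρ θ)‖ := by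
    have h := log_norm_le_circleAverage hρ hg (norm_pos_iff.1 (h0 ▸ one_pos))
    rw [h0, Real.log_one, circleAverage_eq_setIntegral, smul_eq_mul] at h
    exact (mul_nonneg_iff_of_pos_left (by positivity)).1 h
  have hconst : IntegrableOn (fun _ => Real.log B) (Ioo (-π) π) := integrable_const _
  rw [← ofReal_integral_eq_lintegral_ofReal hconst (ae_of_all _ fun _ => Real.log_nonneg hB),
    ← ofReal_integral_eq_lintegral_ofReal (by exact hconst.sub hint) (ae_of_all _ hnonneg),
    integral_sub hconst hint]
  exact ENNReal.ofReal_le_ofReal (sub_le_self _ havg)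

theorem setLIntegral_ball_log_sub_log_norm_le (hg : DifferentiableOn ℂ g (ball 0 r))
    (h0 : ‖g 0‖ = 1) (hB : 1 ≤ B) (hgB : ∀ w ∈ ball 0 r, ‖g w‖ ≤ B) :
    ∫⁻ w in ball 0 r, ENNReal.ofReal (Real.log B - Real.log ‖g w‖) ≤
      ENNReal.ofReal (Real.log B) * volume (ball (0 : ℂ) r) := by
  rw [← setLIntegral_const]
  refine setLIntegral_ball_zero_mono
    (measurable_indicator_comp_of_continuousOn
      (h := fun v : ℂ => ENNReal.ofReal (Real.log B - Real.log ‖v‖)) hg.continuousOn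
      measurableSet_ball (by fun_prop))
    (measurable_const.indicator measurableSet_ball) fun ρ hρ => ?_
  have hsub : closedBall (0 : ℂ) |ρ| ⊆ ball 0 r :=
    closedBall_subset_ball (by rw [abs_of_pos hρ.1]; exact hρ.2)
  exact lintegral_circleMap_log_sub_log_norm_le hρ.1 ((hg.analyticOnNhd isOpen_ball).mono hsub) h0
    hB fun w hw => hgB w (hsub (sphere_subset_closedBall hw))

theorem ae_restrict_ball_ne_zero (hg : DifferentiableOn ℂ g (ball 0 r)) (hr : 0 < r)
    (h0 : g 0 ≠ 0) : ∀ᵐ w ∂volume.restrict (ball 0 r), g w ≠ 0 :=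
  ae_restrict_le_codiscreteWithin measurableSet_ball
    ((hg.analyticOnNhd isOpen_ball).preimage_zero_mem_codiscreteWithin h0 (mem_ball_self hr)
      ((convex_ball 0 r).isConnected ⟨0, mem_ball_self hr⟩))

theorem measurableSet_ball_inter_norm_lt (hg : DifferentiableOn ℂ g (ball 0 r)) (η : ℝ) :
    MeasurableSet (ball 0 r ∩ {w | ‖g w‖ < η}) :=
  (hg.continuousOn.norm.isOpen_inter_preimage isOpen_ball isOpen_Iio).measurableSet

theorem ofReal_mul_volume_norm_lt_le (hg : DifferentiableOn ℂ g (ball 0 r)) (hr : 0 < r)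
    (h0 : ‖g 0‖ = 1) (hB : 1 ≤ B) (hgB : ∀ w ∈ ball 0 r, ‖g w‖ ≤ B) (t : ℝ) :
    ENNReal.ofReal t * volume (ball 0 r ∩ {w | ‖g w‖ < B * Real.exp (-t)}) ≤
      ENNReal.ofReal (Real.log B) * volume (ball (0 : ℂ) r) := by
  set A := ball 0 r ∩ {w | ‖g w‖ < B * Real.exp (-t)}
  have hA : ∀ᵐ w, w ∈ A → ENNReal.ofReal t ≤ ENNReal.ofReal (Real.log B - Real.log ‖g w‖) := by
    filter_upwards [(ae_restrict_iff' measurableSet_ball).1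
      (ae_restrict_ball_ne_zero hg hr (norm_pos_iff.1 (h0 ▸ one_pos)))] with w hne hw
    have hlog := Real.log_le_log (norm_pos_iff.2 (hne hw.1)) (le_of_lt hw.2)
    rw [Real.log_mul (by positivity) (Real.exp_ne_zero _), Real.log_exp] at hlog
    exact ENNReal.ofReal_le_ofReal (by linarith)
  calc ENNReal.ofReal t * volume A = ∫⁻ _ in A, ENNReal.ofReal t := (setLIntegral_const _ _).symm
    _ ≤ ∫⁻ w in A, ENNReal.ofReal (Real.log B - Real.log ‖g w‖) :=
        setLIntegral_mono_ae' (measurableSet_ball_inter_norm_lt hg _) hA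
    _ ≤ ∫⁻ w in ball 0 r, ENNReal.ofReal (Real.log B - Real.log ‖g w‖) :=
        lintegral_mono_set inter_subset_left
    _ ≤ ENNReal.ofReal (Real.log B) * volume (ball (0 : ℂ) r) :=
        setLIntegral_ball_log_sub_log_norm_le hg h0 hB hgB

theorem mul_dA_real_norm_lt_le (hg : DifferentiableOn ℂ g (ball 0 r)) (hr₀ : 0 < r) (hr : r ≤ 1)
    (h0 : ‖g 0‖ = 1) (hB : 1 ≤ B) (hgB : ∀ w ∈ ball 0 r, ‖g w‖ ≤ B) {t : ℝ} (ht : 0 ≤ t) :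
    t * dA.real (ball 0 r ∩ {w | ‖g w‖ < B * Real.exp (-t)}) ≤ Real.log B := by
  have hrd := ball_zero_subset_disk hr
  have hlog := Real.log_nonneg hB
  have h := ENNReal.toReal_mono (by finiteness) (ofReal_mul_volume_norm_lt_le hg hr₀ h0 hB hgB t)
  rw [ENNReal.toReal_mul, ENNReal.toReal_mul, ENNReal.toReal_ofReal ht,
    ENNReal.toReal_ofReal hlog] at h
  calc t * dA.real (ball 0 r ∩ {w | ‖g w‖ < B * Real.exp (-t)})
      ≤ Real.log B * dA.real (ball 0 r) := by
        rw [dA_real_eq_div (inter_subset_left.trans hrd), dA_real_eq_div hrd, ← mul_div_assoc,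
          ← mul_div_assoc]
        exact div_le_div_of_nonneg_right h Real.pi_pos.le
    _ ≤ Real.log B := mul_le_of_le_one_right hlog measureReal_le_one

theorem half_le_dA_real_sdiff_norm_lt (hg : DifferentiableOn ℂ g (ball 0 r)) (hr₀ : 0 < r)
    (hr : r ≤ 1) (h0 : ‖g 0‖ = 1) (hB : 1 ≤ B) (hgB : ∀ w ∈ ball 0 r, ‖g w‖ ≤ B) {δ : ℝ}
    (hδ : 0 < δ) {S : Set ℂ} (hS : δ ≤ dA.real S) :
    δ / 2 ≤ dA.real
      (S \ (ball 0 r ∩ {w | ‖g w‖ < B * Real.exp (-(2 * (Real.log B + 1) / δ))})) := by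
  have hlog := Real.log_nonneg hB
  set t := 2 * (Real.log B + 1) / δ with ht
  have ht₀ : 0 < t := by positivity
  have hsmall := mul_dA_real_norm_lt_le hg hr₀ hr h0 hB hgB ht₀.le
  set A := ball 0 r ∩ {w | ‖g w‖ < B * Real.exp (-t)}
  have hA : dA.real A ≤ δ / 2 := by
    refine le_of_mul_le_mul_left (hsmall.trans ?_) ht₀
    rw [ht, div_mul_div_cancel₀ hδ.ne']
    linarith
  linarith [le_measureReal_sdiff (μ := dA) (s₁ := S) (s₂ := A)]

theorem ofReal_mul_sq_le_setLIntegral_enorm_sq (hg : DifferentiableOn ℂ g (ball 0 r)) (hr₀ : 0 < r)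
    (hr : r ≤ 1) (h0 : ‖g 0‖ = 1) (hB : 1 ≤ B) (hgB : ∀ w ∈ ball 0 r, ‖g w‖ ≤ B) {δ : ℝ}
    (hδ : 0 < δ) {S : Set ℂ} (hSm : MeasurableSet S) (hSr : S ⊆ ball 0 r) (hS : δ ≤ dA.real S) :
    ENNReal.ofReal (δ / 2 * (B * Real.exp (-(2 * (Real.log B + 1) / δ))) ^ 2) ≤
      ∫⁻ w in S, ‖g w‖ₑ ^ 2 ∂dA := by
  have hlarge := half_le_dA_real_sdiff_norm_lt hg hr₀ hr h0 hB hgB hδ hS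
  set η := B * Real.exp (-(2 * (Real.log B + 1) / δ))
  have : 0 ≤ η := by positivity
  set T := S \ (ball 0 r ∩ {w | ‖g w‖ < η})
  have hT : MeasurableSet T := hSm.diff (measurableSet_ball_inter_norm_lt hg η)
  calc ENNReal.ofReal (δ / 2 * η ^ 2) ≤ ENNReal.ofReal (η ^ 2) * dA T := by
        rw [mul_comm, ENNReal.ofReal_mul (by positivity)]
        gcongr
        exact (ENNReal.ofReal_le_ofReal hlarge).trans_eq ofReal_measureReal
    _ = ∫⁻ _ in T, ENNReal.ofReal (η ^ 2) ∂dA := (setLIntegral_const _ _).symm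
    _ ≤ ∫⁻ w in T, ‖g w‖ₑ ^ 2 ∂dA := by
        refine setLIntegral_mono' hT fun w hw => ?_
        have hge : η ≤ ‖g w‖ := not_lt.1 fun h => hw.2 ⟨hSr hw.1, h⟩
        rw [← ofReal_norm_sq]
        gcongr
    _ ≤ ∫⁻ w in S, ‖g w‖ₑ ^ 2 ∂dA := lintegral_mono_set sdiff_subset

theorem exists_mul_enorm_sq_le_setLIntegral (hr₀ : 0 < r) (hr : r ≤ 1) (hB : 1 ≤ B) {δ : ℝ}
    (hδ : 0 < δ) :
    ∃ c, 0 < c ∧ ∀ g : ℂ → ℂ, DifferentiableOn ℂ g (ball 0 r) →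
      (∀ w ∈ ball 0 r, ‖g w‖ ≤ B * ‖g 0‖) →
      ∀ S, MeasurableSet S → S ⊆ ball 0 r → δ ≤ dA.real S →
        ENNReal.ofReal c * ‖g 0‖ₑ ^ 2 ≤ ∫⁻ w in S, ‖g w‖ₑ ^ 2 ∂dA := by
  refine ⟨δ / 2 * (B * Real.exp (-(2 * (Real.log B + 1) / δ))) ^ 2, by positivity,
    fun g hg hgB S hSm hSr hS => ?_⟩
  rcases eq_or_ne (g 0) 0 with h0 | h0
  · simp [h0]
  have hpos := norm_pos_iff.2 h0
  have hle := ofReal_mul_sq_le_setLIntegral_enorm_sq (hg.div_const (g 0)) hr₀ hr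
    (by rw [div_self h0, norm_one]) hB
    (fun w hw => by rw [norm_div, div_le_iff₀ hpos]; exact hgB w hw) hδ hSm hSr hS
  refine (mul_le_mul_left hle _).trans_eq ?_
  rw [← lintegral_mul_const' _ _ (by finiteness)]
  simp only [← mul_pow, ← enorm_mul, div_mul_cancel₀ _ h0]

end Jensen

section WeightedMeans

variable {g : ℂ → ℂ} {r : ℝ}

theorem enorm_mul_dA_ball_le {c : ℂ} (hg : DifferentiableOn ℂ g (ball c r))
    (hr : ball c r ⊆ disk) : ‖g c‖ₑ * dA (ball c r) ≤ ∫⁻ w in ball c r, ‖g w‖ₑ ∂dA := by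
  rw [← setLIntegral_const, setLIntegral_dA hr, setLIntegral_dA hr, setLIntegral_const]
  gcongr
  exact enorm_mul_volume_ball_le hg

theorem ofReal_pow_mul_enorm_sq_le_lintegral (hg : DifferentiableOn ℂ g disk) {u : ℂ} {s : ℝ}
    (hs : 0 ≤ s) (hu : ‖u‖ + 2 * s ≤ 1) :
    ENNReal.ofReal (s ^ 4) * ‖g u‖ₑ ^ 2 ≤
      ∫⁻ w, ENNReal.ofReal ((1 - ‖w‖ ^ 2) ^ 2) * ‖g w‖ₑ ^ 2 ∂dA := by
  have hnorm {w : ℂ} (hw : w ∈ ball u s) : ‖w‖ < 1 - s := by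
    linarith [norm_lt_of_mem_ball hw]
  have hsub : ball u s ⊆ disk := fun w hw => mem_disk.2 ((hnorm hw).trans_le (by linarith))
  have hmean := enorm_mul_dA_ball_le ((hg.pow 2).mono hsub) hsub
  simp only [Pi.pow_apply, enorm_pow] at hmean
  have hball : dA (ball u s) = ENNReal.ofReal (s ^ 2) := by
    rw [← ofReal_measureReal, dA_real_ball hs hsub]
  calc ENNReal.ofReal (s ^ 4) * ‖g u‖ₑ ^ 2
      = ENNReal.ofReal (s ^ 2) * (‖g u‖ₑ ^ 2 * dA (ball u s)) := by
        rw [hball, mul_comm (‖g u‖ₑ ^ 2), ← mul_assoc, ← ENNReal.ofReal_mul (by positivity),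
          ← pow_add]
    _ ≤ ∫⁻ w in ball u s, ENNReal.ofReal (s ^ 2) * ‖g w‖ₑ ^ 2 ∂dA := by
        rw [lintegral_const_mul' _ _ ENNReal.ofReal_ne_top]
        gcongr
    _ ≤ ∫⁻ w in ball u s, ENNReal.ofReal ((1 - ‖w‖ ^ 2) ^ 2) * ‖g w‖ₑ ^ 2 ∂dA := by
        refine setLIntegral_mono' measurableSet_ball fun w hw => ?_
        have hle : s ≤ 1 - ‖w‖ ^ 2 := by nlinarith [hnorm hw, norm_nonneg w]
        gcongr
    _ ≤ ∫⁻ w, ENNReal.ofReal ((1 - ‖w‖ ^ 2) ^ 2) * ‖g w‖ₑ ^ 2 ∂dA := setLIntegral_le_lintegral _ _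

theorem norm_le_mul_norm_zero_of_lintegral_le (hg : DifferentiableOn ℂ g disk) {K : ℝ}
    (hK : 1 ≤ K)
    (hgK : ∫⁻ w, ENNReal.ofReal ((1 - ‖w‖ ^ 2) ^ 2) * ‖g w‖ₑ ^ 2 ∂dA ≤
      ENNReal.ofReal K * ‖g 0‖ₑ ^ 2) {u : ℂ} {s : ℝ} (hs : 0 < s) (hu : ‖u‖ + 2 * s ≤ 1) :
    ‖g u‖ ≤ K / s ^ 2 * ‖g 0‖ := by
  have h := (ofReal_pow_mul_enorm_sq_le_lintegral hg hs.le hu).trans hgK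
  rw [← ofReal_norm_sq, ← ofReal_norm_sq, ← ENNReal.ofReal_mul (by positivity),
    ← ENNReal.ofReal_mul (by positivity), ENNReal.ofReal_le_ofReal_iff (by positivity)] at h
  rw [div_mul_eq_mul_div, le_div_iff₀ (by positivity)]
  refine le_of_sq_le_sq ?_ (by positivity)
  calc (‖g u‖ * s ^ 2) ^ 2 = s ^ 4 * ‖g u‖ ^ 2 := by ring
    _ ≤ K * ‖g 0‖ ^ 2 := h
    _ ≤ K ^ 2 * ‖g 0‖ ^ 2 := by gcongr; exact le_self_pow₀ hK two_ne_zero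
    _ = (K * ‖g 0‖) ^ 2 := by ring

theorem exists_mul_enorm_sq_le_of_lintegral_le (hr₀ : 0 < r) (hr : r < 1) {K : ℝ} (hK : 1 ≤ K)
    {δ : ℝ} (hδ : 0 < δ) :
    ∃ c, 0 < c ∧ ∀ g : ℂ → ℂ, DifferentiableOn ℂ g disk →
      ∫⁻ w, ENNReal.ofReal ((1 - ‖w‖ ^ 2) ^ 2) * ‖g w‖ₑ ^ 2 ∂dA ≤
        ENNReal.ofReal K * ‖g 0‖ₑ ^ 2 →
      ∀ S, MeasurableSet S → S ⊆ ball 0 r → δ ≤ dA.real S →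
        ENNReal.ofReal c * ‖g 0‖ₑ ^ 2 ≤ ∫⁻ w in S, ‖g w‖ₑ ^ 2 ∂dA := by
  set s := (1 - r) / 2 with hs
  have hs₀ : 0 < s := by linarith
  have hB : 1 ≤ K / s ^ 2 := by
    rw [one_le_div (by positivity)]
    exact (pow_le_one₀ hs₀.le (by linarith)).trans hK
  obtain ⟨c, hc, hcS⟩ := exists_mul_enorm_sq_le_setLIntegral hr₀ hr.le hB hδ
  refine ⟨c, hc, fun g hg hgK => hcS g (hg.mono (ball_zero_subset_disk hr.le)) fun w hw => ?_⟩
  exact norm_le_mul_norm_zero_of_lintegral_le hg hK hgK hs₀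
    (by linarith [mem_ball_zero_iff.1 hw])

/-- The average of `h` with weight `(1 - |u|²)²` over the disk, transported to `z` by `mobius z`. -/
def weightedMean (h : ℂ → ℝ≥0∞) (z : ℂ) : ℝ≥0∞ :=
  ∫⁻ u, ENNReal.ofReal ((1 - ‖u‖ ^ 2) ^ 2) * h (mobius z u) ∂dA

/-- The integral kernel that represents `weightedMean` with respect to `dA`. -/
def meanKernel (z w : ℂ) : ℝ := berezinKernel z w * (1 - ‖mobius z w‖ ^ 2) ^ 2

variable {z w : ℂ} {h : ℂ → ℝ≥0∞}

theorem measurable_mobius_uncurry : Measurable fun p : ℂ × ℂ => mobius p.1 p.2 := by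
  unfold mobius
  fun_prop

theorem measurable_meanKernel : Measurable fun p : ℂ × ℂ => meanKernel p.1 p.2 := by
  unfold meanKernel berezinKernel
  have := measurable_mobius_uncurry
  fun_prop

theorem weightedMean_eq_lintegral_meanKernel (hz : z ∈ disk) (h : ℂ → ℝ≥0∞) :
    weightedMean h z = ∫⁻ w, ENNReal.ofReal (meanKernel z w) * h w ∂dA := by
  have hcomp := lintegral_comp_mobius hz
    fun w => ENNReal.ofReal ((1 - ‖mobius z w‖ ^ 2) ^ 2) * h w
  simp only [← mul_assoc, ← ENNReal.ofReal_mul (berezinKernel_nonneg z _)] at hcomp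
  refine Eq.trans (lintegral_congr_ae ?_) hcomp
  filter_upwards [ae_mem_disk] with u hu
  rw [mobius_mobius hz hu]

theorem measurable_weightedMean (hh : Measurable h) : Measurable (weightedMean h) :=
  Measurable.lintegral_prod_right'
    (f := fun p : ℂ × ℂ => ENNReal.ofReal ((1 - ‖p.2‖ ^ 2) ^ 2) * h (mobius p.1 p.2))
    (.mul (by fun_prop) (hh.comp measurable_mobius_uncurry))

theorem meanKernel_le (hz : z ∈ disk) (hw : w ∈ disk) :
    meanKernel z w ≤ 16 * berezinKernel w z := by
  have hpos := norm_one_sub_conj_mul_pos hz hw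
  have hcomm : meanKernel z w =
      (1 - ‖z‖ ^ 2) ^ 2 * berezinKernel z w * berezinKernel w z := by
    rw [meanKernel, one_sub_norm_mobius_sq hz hw, berezinKernel, berezinKernel,
      norm_one_sub_conj_mul_comm w z]
    field_simp
  have ha := one_sub_norm_sq_pos hz
  have hle := berezinKernel_le hz hw
  rw [le_div_iff₀' (by positivity)] at hle
  exact hcomm.trans_le (mul_le_mul_of_nonneg_right hle (berezinKernel_nonneg w z))

theorem lintegral_meanKernel_left_le (hw : w ∈ disk) :
    ∫⁻ z, ENNReal.ofReal (meanKernel z w) ∂dA ≤ 16 := by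
  calc ∫⁻ z, ENNReal.ofReal (meanKernel z w) ∂dA
      ≤ ∫⁻ z, ENNReal.ofReal (16 * berezinKernel w z) ∂dA := by
        refine lintegral_mono_ae ?_
        filter_upwards [ae_mem_disk] with z hz
        exact ENNReal.ofReal_le_ofReal (meanKernel_le hz hw)
    _ = 16 := by
        rw [← ofReal_integral_eq_lintegral_ofReal ((integrable_berezinKernel hw).const_mul 16)
          (ae_of_all _ fun z => mul_nonneg (by norm_num) (berezinKernel_nonneg w z)),
          integral_const_mul, integral_berezinKernel hw, mul_one, ENNReal.ofReal_ofNat]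

theorem lintegral_weightedMean_le (hh : Measurable h) :
    ∫⁻ z, weightedMean h z ∂dA ≤ 16 * ∫⁻ w, h w ∂dA := by
  have hmeas : Measurable fun p : ℂ × ℂ => ENNReal.ofReal (meanKernel p.1 p.2) * h p.2 :=
    measurable_meanKernel.ennreal_ofReal.mul (hh.comp measurable_snd)
  have hleft (w : ℂ) : Measurable fun z => ENNReal.ofReal (meanKernel z w) :=
    (measurable_meanKernel.comp measurable_prodMk_right).ennreal_ofReal
  calc ∫⁻ z, weightedMean h z ∂dA
      = ∫⁻ z, ∫⁻ w, ENNReal.ofReal (meanKernel z w) * h w ∂dA ∂dA := by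
        refine lintegral_congr_ae ?_
        filter_upwards [ae_mem_disk] with z hz using weightedMean_eq_lintegral_meanKernel hz h
    _ = ∫⁻ w, (∫⁻ z, ENNReal.ofReal (meanKernel z w) ∂dA) * h w ∂dA := by
        rw [lintegral_lintegral_swap hmeas.aemeasurable]
        simp only [lintegral_mul_const _ (hleft _)]
    _ ≤ ∫⁻ w, 16 * h w ∂dA := by
        refine lintegral_mono_ae ?_
        filter_upwards [ae_mem_disk] with w hw
        gcongr
        exact lintegral_meanKernel_left_le hw
    _ = 16 * ∫⁻ w, h w ∂dA := lintegral_const_mul _ hh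

end WeightedMeans

section Luecking

variable {G : Set ℂ} {r δ : ℝ} {z : ℂ}

theorem ofReal_mul_setLIntegral_comp_mobius_le_weightedMean (hr : r ≤ 1) (hG : MeasurableSet G)
    (h : ℂ → ℝ≥0∞) (z : ℂ) :
    ENNReal.ofReal ((1 - r ^ 2) ^ 2) * ∫⁻ u in ball 0 r ∩ mobius z ⁻¹' G, h (mobius z u) ∂dA ≤
      weightedMean (G.indicator h) z := by
  have hS : MeasurableSet (ball 0 r ∩ mobius z ⁻¹' G) :=
    measurableSet_ball.inter (measurable_mobius z hG)
  rw [← lintegral_const_mul' _ _ ENNReal.ofReal_ne_top]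
  refine (setLIntegral_mono' hS fun u hu => ?_).trans (setLIntegral_le_lintegral _ _)
  have hur : ‖u‖ < r := mem_ball_zero_iff.1 hu.1
  have hr₀ : 0 ≤ r := (norm_nonneg u).trans hur.le
  have hr₁ : 0 ≤ 1 - r ^ 2 := sub_nonneg.2 (pow_le_one₀ hr₀ hr)
  rw [indicator_of_mem (mem_preimage.1 hu.2)]
  gcongr

/- Luecking's dichotomy. If the mean of `‖f‖²` around `z` exceeds `32 * ‖f z‖²`, the first summand
on the right suffices; otherwise the lower bound for `f ∘ mobius z` applies. As averaging multiplies
integrals by at most `16`, the first summand is later absorbed by half of the left-hand side. -/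
theorem exists_mul_enorm_sq_le_weightedMean_add (hr₀ : 0 < r) (hr : r < 1) (hδ : 0 < δ) :
    ∃ C, 0 < C ∧ ∀ f : ℂ → ℂ, DifferentiableOn ℂ f disk → ∀ G, MeasurableSet G → ∀ z ∈ disk,
      δ ≤ dA.real (ball 0 r ∩ mobius z ⁻¹' G) →
        32 * (ENNReal.ofReal C * ‖f z‖ₑ ^ 2) ≤
          ENNReal.ofReal C * weightedMean (fun w => ‖f w‖ₑ ^ 2) z +
            weightedMean (G.indicator fun w => ‖f w‖ₑ ^ 2) z := by
  obtain ⟨c, hc, hcS⟩ :=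
    exists_mul_enorm_sq_le_of_lintegral_le hr₀ hr (K := 32) (by norm_num) hδ
  have hr₁ : 0 < 1 - r ^ 2 := sub_pos.2 (pow_lt_one₀ hr₀.le hr two_ne_zero)
  refine ⟨(1 - r ^ 2) ^ 2 * c / 32, by positivity, fun f hf G hG z hz hδG => ?_⟩
  rcases le_total (weightedMean (fun w => ‖f w‖ₑ ^ 2) z) (32 * ‖f z‖ₑ ^ 2) with hsmall | hlarge
  · have hlower := hcS (f ∘ mobius z)
      (hf.comp (differentiableOn_mobius hz) fun _ => mobius_mem_disk hz)
      (by simpa [weightedMean, mobius_zero] using hsmall) _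
      (measurableSet_ball.inter (measurable_mobius z hG)) inter_subset_left hδG
    simp only [Function.comp_apply, mobius_zero] at hlower
    refine le_trans ?_ le_add_self
    calc 32 * (ENNReal.ofReal ((1 - r ^ 2) ^ 2 * c / 32) * ‖f z‖ₑ ^ 2)
        = ENNReal.ofReal ((1 - r ^ 2) ^ 2) * (ENNReal.ofReal c * ‖f z‖ₑ ^ 2) := by
          rw [← ENNReal.ofReal_ofNat 32, ← mul_assoc, ← mul_assoc,
            ← ENNReal.ofReal_mul (by norm_num), ← ENNReal.ofReal_mul (by positivity),
            mul_div_cancel₀ _ (by norm_num)]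
      _ ≤ ENNReal.ofReal ((1 - r ^ 2) ^ 2) *
            ∫⁻ u in ball 0 r ∩ mobius z ⁻¹' G, ‖f (mobius z u)‖ₑ ^ 2 ∂dA := by gcongr
      _ ≤ _ := ofReal_mul_setLIntegral_comp_mobius_le_weightedMean hr.le hG (fun w => ‖f w‖ₑ ^ 2) z
  · refine le_trans ?_ le_self_add
    rw [mul_left_comm]
    gcongr

theorem mul_lintegral_le_setLIntegral_of_weightedMean {h : ℂ → ℝ≥0∞} (hh : Measurable h)
    (hfin : ∫⁻ w, h w ∂dA ≠ ∞) (hG : MeasurableSet G) {C : ℝ≥0∞} (hC : C ≠ ∞)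
    (hle : ∀ z ∈ disk, 32 * (C * h z) ≤ C * weightedMean h z + weightedMean (G.indicator h) z) :
    C * ∫⁻ w, h w ∂dA ≤ ∫⁻ w in G, h w ∂dA := by
  have habsorb : 16 * (C * ∫⁻ w, h w ∂dA) + 16 * (C * ∫⁻ w, h w ∂dA) ≤
      16 * (C * ∫⁻ w, h w ∂dA) + 16 * ∫⁻ w in G, h w ∂dA := by
    calc 16 * (C * ∫⁻ w, h w ∂dA) + 16 * (C * ∫⁻ w, h w ∂dA)
        = ∫⁻ z, 32 * (C * h z) ∂dA := by
          rw [lintegral_const_mul _ (hh.const_mul C), lintegral_const_mul _ hh, ← add_mul]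
          norm_num
      _ ≤ ∫⁻ z, (C * weightedMean h z + weightedMean (G.indicator h) z) ∂dA := by
          refine lintegral_mono_ae ?_
          filter_upwards [ae_mem_disk] with z hz using hle z hz
      _ = C * ∫⁻ z, weightedMean h z ∂dA + ∫⁻ z, weightedMean (G.indicator h) z ∂dA := by
          rw [lintegral_add_left ((measurable_weightedMean hh).const_mul C),
            lintegral_const_mul _ (measurable_weightedMean hh)]
      _ ≤ C * (16 * ∫⁻ w, h w ∂dA) + 16 * ∫⁻ w, G.indicator h w ∂dA := by
          gcongr
          exacts [lintegral_weightedMean_le hh, lintegral_weightedMean_le (hh.indicator hG)]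
      _ = 16 * (C * ∫⁻ w, h w ∂dA) + 16 * ∫⁻ w in G, h w ∂dA := by
          rw [lintegral_indicator hG, mul_left_comm]
  exact (ENNReal.mul_le_mul_iff_right (by norm_num) (by norm_num)).1
    (ENNReal.le_of_add_le_add_left (by finiteness) habsorb)

theorem le_dA_real_ball_inter_preimage_mobius (hz : z ∈ disk) (hr₀ : 0 ≤ r) (hr : r < 1)
    (hδ : 0 ≤ δ) (hG : MeasurableSet G)
    (h : δ * dA.real (pseudoDisk z r) ≤ dA.real (pseudoDisk z r ∩ G)) :
    (1 - r) ^ 4 * δ * r ^ 2 / 16 ≤ dA.real (ball 0 r ∩ mobius z ⁻¹' G) := by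
  have hball : ball 0 r ⊆ disk := ball_zero_subset_disk hr.le
  rw [pseudoDisk_inter hz hr.le, pseudoDisk_eq_image hz hr.le] at h
  have hupper := dA_real_le_mul_dA_real_mobius_image hz measurableSet_ball hball
  have hlower := mul_dA_real_mobius_image_le hz hr
    (measurableSet_ball.inter (measurable_mobius z hG)) inter_subset_left
  rw [dA_real_ball hr₀ hball] at hupper
  have ha : 0 < (1 - ‖z‖ ^ 2) ^ 2 := pow_pos (one_sub_norm_sq_pos hz) 2
  have hr₁ : 0 < 1 - r := sub_pos.2 hr
  calc (1 - r) ^ 4 * δ * r ^ 2 / 16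
      ≤ (1 - r) ^ 4 * δ * (16 / (1 - ‖z‖ ^ 2) ^ 2 * dA.real (mobius z '' ball 0 r)) / 16 := by
        gcongr
    _ = (1 - r) ^ 4 / (1 - ‖z‖ ^ 2) ^ 2 * (δ * dA.real (mobius z '' ball 0 r)) := by
        field_simp
    _ ≤ (1 - r) ^ 4 / (1 - ‖z‖ ^ 2) ^ 2 * dA.real (mobius z '' (ball 0 r ∩ mobius z ⁻¹' G)) := by
        gcongr
    _ ≤ dA.real (ball 0 r ∩ mobius z ⁻¹' G) := hlower

theorem isReverseCarleson_charMeasure_of_measurableSet (hG : MeasurableSet G) (hr₀ : 0 < r)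
    (hr : r < 1) (hδ : 0 < δ)
    (h : ∀ z ∈ disk, δ * dA.real (pseudoDisk z r) ≤ dA.real (pseudoDisk z r ∩ G)) :
    IsReverseCarleson (charMeasure G) := by
  have : 0 < 1 - r := sub_pos.2 hr
  obtain ⟨C, hC, hCG⟩ := exists_mul_enorm_sq_le_weightedMean_add hr₀ hr
    (show 0 < (1 - r) ^ 4 * δ * r ^ 2 / 16 by positivity)
  refine ⟨C, hC, fun f hf => ?_⟩
  set g := disk.indicator f
  have hgf : EqOn g f disk := fun w hw => indicator_of_mem hw f
  have hg : Measurable fun w => ‖g w‖ₑ ^ 2 :=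
    (measurable_indicator_comp_of_continuousOn hf.1.continuousOn measurableSet_disk
      measurable_id).enorm.pow_const 2
  have hae : ∀ᵐ w ∂dA, ‖g w‖ₑ ^ 2 = ‖f w‖ₑ ^ 2 := by
    filter_upwards [ae_mem_disk] with w hw
    rw [hgf hw]
  have hfin : ∫⁻ w, ‖g w‖ₑ ^ 2 ∂dA ≠ ∞ := by
    have hpow := eLpNorm_nnreal_pow_eq_lintegral (f := f) (μ := dA) (p := 2) two_ne_zero
    simp only [NNReal.coe_ofNat, ENNReal.coe_ofNat, ENNReal.rpow_ofNat] at hpow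
    rw [lintegral_congr_ae hae, ← hpow]
    exact ENNReal.pow_ne_top hf.2.eLpNorm_ne_top
  have hle := mul_lintegral_le_setLIntegral_of_weightedMean hg hfin hG ENNReal.ofReal_ne_top
    fun z hz => hCG g (hf.1.congr hgf) G hG z hz
      (le_dA_real_ball_inter_preimage_mobius hz hr₀.le hr hδ.le hG (h z hz))
  rwa [charMeasure,
    restrict_disk_of_absolutelyContinuous Measure.restrict_le_self.absolutelyContinuous,
    restrict_disk_dA, ← lintegral_congr_ae hae, ← lintegral_congr_ae (ae_restrict_of_ae hae)]

theorem isReverseCarleson_charMeasure (hG : NullMeasurableSet G dA) (hr₀ : 0 < r) (hr : r < 1)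
    (hδ : 0 < δ)
    (h : ∀ z ∈ disk, δ * dA.real (pseudoDisk z r) ≤ dA.real (pseudoDisk z r ∩ G)) :
    IsReverseCarleson (charMeasure G) := by
  obtain ⟨G', -, hG', hae⟩ := hG.exists_measurable_subset_ae_eq
  rw [charMeasure, ← Measure.restrict_congr_set hae]
  refine isReverseCarleson_charMeasure_of_measurableSet hG' hr₀ hr hδ fun z hz => ?_
  rw [measureReal_congr ((ae_eq_refl (pseudoDisk z r)).inter hae)]
  exact h z hz

theorem ReverseCarlesonCondition.exists_isReverseCarleson_charMeasure {φ : ℂ → ℝ}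
    (hφ : MemLp φ ∞ dA) (h : ReverseCarlesonCondition (measureOf φ)) :
    ∃ t, 0 < t ∧ IsReverseCarleson (charMeasure {z | z ∈ disk ∧ t < φ z}) := by
  obtain ⟨r, hr₀, hr, c, hc, hcE⟩ :=
    (reverseCarlesonCondition_iff_of_le_smul (measureOf_le_smul hφ)).1 h
  have hM : 0 ≤ lpNorm φ ∞ dA := lpNorm_nonneg
  refine ⟨c / 2, half_pos hc, isReverseCarleson_charMeasure
    (nullMeasurableSet_superlevel hφ.1.aemeasurable _) hr₀ hr
    (show 0 < c / 2 / (lpNorm φ ∞ dA + 1) by positivity) fun z hz => ?_⟩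
  have hsplit := measureReal_measureOf_le hφ (half_pos hc).le (S := pseudoDisk z r) fun w hw => hw.1
  rw [div_mul_eq_mul_div, div_le_iff₀ (by positivity)]
  linarith [hcE z hz, measureReal_nonneg (μ := dA)
    (s := pseudoDisk z r ∩ {w | w ∈ disk ∧ c / 2 < φ w})]

end Luecking

end Bergman
end

theorem theoremM1 (φ : ℂ → ℝ) (hφ : MemLp φ ∞ Bergman.dA)
    (hpos : ∀ᵐ z ∂Bergman.dA, 0 ≤ φ z) :
    List.TFAE [
      IsUnit (Bergman.toeplitz (fun z => (φ z : ℂ)) hφ.ofReal),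
      Bergman.IsInvertibleLinfty (Bergman.berezin (Bergman.measureOf φ)),
      Bergman.IsBoundedBelowOnDisk (Bergman.berezin (Bergman.measureOf φ)),
      ∃ r : ℝ, 0 < r ∧
        Bergman.IsReverseCarleson (Bergman.charMeasure {z | z ∈ Bergman.disk ∧ r < φ z}),
      Bergman.IsReverseCarleson (Bergman.measureOf φ),
      Bergman.ReverseCarlesonCondition (Bergman.measureOf φ)] := by
  have hle := Bergman.measureOf_le_smul hφ
  have := Bergman.isFiniteMeasure_measureOf hφ
  tfae_have 1 ↔ 5 := Bergman.isUnit_toeplitz_iff hφ hpos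
  tfae_have 2 ↔ 3 := Bergman.isInvertibleLinfty_iff_isBoundedBelowOnDisk
    (Bergman.continuousOn_berezin _) fun z hz =>
      (abs_of_nonneg (Bergman.berezin_nonneg _ z)).trans_le (Bergman.berezin_le_of_le_smul hle hz)
  tfae_have 5 → 3 := fun h => h.isBoundedBelowOnDisk_berezin
  tfae_have 3 → 6 := fun h => h.reverseCarlesonCondition hle
  tfae_have 6 → 4 := fun h => h.exists_isReverseCarleson_charMeasure hφ
  tfae_have 4 → 5 := fun ⟨r, hr, h⟩ =>
    h.of_smul_le hr (Bergman.smul_charMeasure_superlevel_le hφ.1.aemeasurable r)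
  tfae_finish
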